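/- **Setting.** Let $(\Omega,P)$ be a standard Borel probability space, $Z,\eta$ real random variables, $X$ a random vector in $\mathbb R^k$, and $\varepsilon$ a random element of a standard Borel space. Let $m,h$ be jointly measurable functions, $m(d,x,e)$ being continuously differentiable in $d$ for each $(x,e)$, and let $$Y=m(D,X,\varepsilon),\qquad D=h(Z,X,\eta),\qquad Y^t=m(\pi_t(D),X,\varepsilon)\quad(t\in[0,1]),$$ where the functions $\pi_t$ are measurable, $\pi_0(d)=d$, and for each $d$ the map $t\mapsto\pi_t(d)$ is continuously differentiable at $t=0$ with derivative $\dot\pi(d)$, $\dot\pi$ bounded. Put $\dot m=\dot\pi\,\partial_d m$. Write $F_Y$ for the CDF of $Y$, $f_Y=F_Y'$, $Q_\tau(F)=\inf\{y:F(y)\ge\tau\}$, $q_\tau=Q_\tau(F_Y)$, $\theta_Q(\tau)=\lim_{t\downarrow0}\{Q_\tau(F_{Y^t})-Q_\tau(F_Y)\}/t$, and $V=F_{D|Z,X}(D|Z,X)$. Conditional laws given $(D,V,X)=(d,v,x)$ are taken from a regular conditional distribution of $\varepsilon$ given $(D,V,X)$ (so $F_{Y|D,V,X}(y|d,v,x)$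 is the conditional probability of $m(d,x,\varepsilon)\le y$), and $f_{Y|D,V,X}=\partial_yF_{Y|D,V,X}$. Let $S(d,v,x)$ be the support of the conditional law of $Y$ given $(D,V,X)=(d,v,x)$. Derivatives $\partial_d$ of conditional CDFs and quantiles are taken for $d$ within $\operatorname{supp}D$. "Dominated by $g$" below means bounded by $C|g(y')|$ for a constant $C$ and an integrable $g:\mathbb R\to\mathbb R$ with $\int|y'g(y')|\,dy'<\infty$. **Assumptions.** 1. $\operatorname{supp}Y=[a,b]$ is a compact interval; $F_Y$ is continuously differentiable with $f_Y>0$ on $(a,b)$; for every $\nu>0$, $P[|m(\pi_t(D),X,\varepsilon)-m(D,X,\varepsilon)-t\,\dot m(D,X,\varepsilon)|\ge\nu t]=o(t)$ as $t\downarrow0$; $(Y,\dot m(D,X,\varepsilon))$ has a joint density $f_{Y,\dot m}(y,y')$ that is continuous in $y\in(a,b)$ for each $y'$ and dominated by some $g$. 2. $(\varepsilon,\eta)\perp Z\mid X$; almost surely $p\mapsto h(Z,X,p)$ is strictly monotonic on the support of $\eta$ (almost surely increasing, or almost surely decreasing); for almost every $x$, $F_{\eta|X}(\cdot|x)$ is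 continuous, and strictly increasing on its support. 3. $D$ is continuous in the sense that, for almost every $(v,x)$, the conditional law of $D$ given $(V,X)=(v,x)$ has no atoms. 4. For each $(d,v,x)\in\operatorname{supp}D\times\operatorname{supp}V\times\operatorname{supp}X$: the conditional law of $Y$ is absolutely continuous, with density $f_{Y|D,V,X}(\cdot|d,v,x)$ strictly positive, bounded and continuous on the interior of $S(d,v,x)$; $d\mapsto F_{Y|D,V,X}(y|d,v,x)$ is continuously differentiable on $\operatorname{supp}D$ for every $y$, and $d\mapsto Q_{Y|D,V,X}(\alpha|d,v,x)$ is differentiable there for every $\alpha\in(0,1)$; for every $\nu>0$, $P[|m(d+\delta,x,\varepsilon)-m(d,x,\varepsilon)-\delta\,\partial_dm(d,x,\varepsilon)|\ge\nu\delta\mid D=d,V=v,X=x]=o(\delta)$ as $\delta\downarrow0$; the conditional law of $(Y,\partial_dm(d,x,\varepsilon))$ has a joint density that is continuous in $y$ on the interior of $S(d,v,x)$ for each $y'$, and dominated by $g$, with $g$ and $C$ not depending on $(d,v,x)$. 5. For every $y\in(a,b)$, almost surely $y$ is not a boundary point of $S(D,V,X)$ (for instance, $S(d,v,x)=[a,b]$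 for all $(d,v,x)$). **Claim.** There is a regular conditional distribution $F_{D,V,X|Y}(\cdot|y)$ of $(D,V,X)$ given $Y=y$ that is weakly continuous in $y\in(a,b)$ (hence unique there). For every $\tau\in(0,1)$ the limit $\theta_Q(\tau)$ exists, the three integrands below are integrable, and $$\begin{aligned}\theta_Q(\tau)&=\frac{-1}{f_Y(q_\tau)}\int\dot\pi(d)\,\partial_dF_{Y|D,V,X}(q_\tau|d,v,x)\,dF_{D,V,X}(d,v,x)\\&=\int\dot\pi(d)\,\omega_{q_\tau}(d,v,x)\,\beta^{\mathrm{CQD}}(\zeta_\tau(d,v,x),d,v,x)\,dF_{D,V,X}(d,v,x)\\&=\int\dot\pi(d)\,\beta^{\mathrm{CQD}}(\zeta_\tau(d,v,x),d,v,x)\,dF_{D,V,X|Y}(d,v,x|q_\tau),\end{aligned}$$ where $\omega_y(d,v,x)=f_{Y|D,V,X}(y|d,v,x)/f_Y(y)$, $\beta^{\mathrm{CQD}}(\alpha,d,v,x)=\partial_dQ_{Y|D,V,X}(\alpha|d,v,x)$, and $\zeta_\tau(d,v,x)$ is the element of $\{\alpha\in(0,1):Q_{Y|D,V,X}(\alpha|d,v,x)=q_\tau\}$,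 which is a singleton for $F_{D,V,X}$-almost every $(d,v,x)$ with $\omega_{q_\tau}(d,v,x)\ne0$. -/

import Mathlib

open MeasureTheory ProbabilityTheory Filter Topology Set Asymptotics

noncomputable section

/-- The quantile functional `Q_τ : F ↦ inf {y : F y ≥ τ}`. -/
def quantile (F : ℝ → ℝ) (τ : ℝ) : ℝ := sInf {y : ℝ | τ ≤ F y}

/-- `θ` is the marginal policy effect `lim_{t ↓ 0} (Γ(F_{Y^t}) - Γ(F_Y)) / t`, where `Ycf t` is the
counterfactual outcome `Y^t` and `Y` is the status quo outcome. -/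
def IsMarginalPolicyEffect {Ω : Type*} [MeasurableSpace Ω] (P : Measure Ω) (Γ : (ℝ → ℝ) → ℝ)
    (Y : Ω → ℝ) (Ycf : ℝ → Ω → ℝ) (θ : ℝ) : Prop :=
  Tendsto (fun t : ℝ => (Γ (cdf (P.map (Ycf t))) - Γ (cdf (P.map Y))) / t) (𝓝[>] 0) (𝓝 θ)

/-- Covariate vectors. -/
abbrev Covariates (k : ℕ) : Type := EuclideanSpace ℝ (Fin k)

/-- The triangular system `Y = m(D, X, ε)`, `D = h(Z, X, η)` together with a family of policy
functions `π_t`, `t ∈ [0, 1]`. The disturbance `ε` may take values in any measurable space,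
the disturbance `η` is one-dimensional. -/
structure TriangularModel (Ω E : Type*) [MeasurableSpace Ω] [MeasurableSpace E] (k : ℕ) where
  Z : Ω → ℝ
  X : Ω → Covariates k
  ε : Ω → E
  η : Ω → ℝ
  /-- the selection equation -/
  h : ℝ → Covariates k → ℝ → ℝ
  /-- the outcome equation -/
  m : ℝ → Covariates k → E → ℝ
  /-- the policy functions: `policy t d` is `π_t(d)` -/
  policy : ℝ → ℝ → ℝ
  measurable_Z : Measurable Z
  measurable_X : Measurable X
  measurable_ε : Measurable ε
  measurable_η : Measurable η
  measurable_h : Measurable fun p : ℝ × Covariates k × ℝ => h p.1 p.2.1 p.2.2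
  measurable_m : Measurable fun p : ℝ × Covariates k × E => m p.1 p.2.1 p.2.2
  contDiff_m : ∀ x e, ContDiff ℝ 1 fun d => m d x e
  measurable_policy : ∀ t ∈ Icc (0 : ℝ) 1, Measurable (policy t)
  policy_zero : ∀ d, policy 0 d = d
  contDiff_policy : ∀ d, ContDiffWithinAt ℝ 1 (fun t => policy t d) (Icc 0 1) 0
  bounded_policy : ∃ B : ℝ, ∀ d, |derivWithin (fun t => policy t d) (Icc 0 1) 0| ≤ B

namespace TriangularModel

variable {Ω E : Type*} [MeasurableSpace Ω] [MeasurableSpace E] {k : ℕ}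

/-- The policy variable `D = h(Z, X, η)`. -/
def D (M : TriangularModel Ω E k) (ω : Ω) : ℝ := M.h (M.Z ω) (M.X ω) (M.η ω)

/-- The status quo outcome `Y = m(D, X, ε)`. -/
def Y (M : TriangularModel Ω E k) (ω : Ω) : ℝ := M.m (M.D ω) (M.X ω) (M.ε ω)

/-- The counterfactual outcome `Y^t = m(π_t(D), X, ε)`. -/
def Ycf (M : TriangularModel Ω E k) (t : ℝ) (ω : Ω) : ℝ :=
  M.m (M.policy t (M.D ω)) (M.X ω) (M.ε ω)

/-- The derivative of the policy function, `∂_t π_t(d)` at `t = 0`. -/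
def policyDot (M : TriangularModel Ω E k) (d : ℝ) : ℝ :=
  derivWithin (fun t => M.policy t d) (Icc 0 1) 0

/-- The structural derivative `∂_d m(d, x, e)`. -/
def dm (M : TriangularModel Ω E k) (d : ℝ) (x : Covariates k) (e : E) : ℝ :=
  deriv (fun d' => M.m d' x e) d

/-- `∂_t m(π_t(d), x, e)` at `t = 0`, that is, `π̇(d) ∂_d m(d, x, e)`. -/
def mDot (M : TriangularModel Ω E k) (d : ℝ) (x : Covariates k) (e : E) : ℝ :=
  M.policyDot d * M.dm d x e

/-- The control variable `V = F_{D|Z,X}(D | Z, X)`. -/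
def V (M : TriangularModel Ω E k) (P : Measure Ω) [IsFiniteMeasure P] (ω : Ω) : ℝ :=
  cdf (condDistrib M.D (fun ω' => (M.Z ω', M.X ω')) P (M.Z ω, M.X ω)) (M.D ω)

/-- The random vector `(D, V, X)`. -/
def W (M : TriangularModel Ω E k) (P : Measure Ω) [IsFiniteMeasure P] (ω : Ω) :
    ℝ × ℝ × Covariates k :=
  (M.D ω, M.V P ω, M.X ω)

/-- The support of `Y`. -/
def suppY (M : TriangularModel Ω E k) (P : Measure Ω) : Set ℝ := (P.map M.Y).support

/-- The support of `D`. -/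
def suppD (M : TriangularModel Ω E k) (P : Measure Ω) : Set ℝ := (P.map M.D).support

/-- The density `f_Y`, as the derivative of the CDF `F_Y`. -/
def fY (M : TriangularModel Ω E k) (P : Measure Ω) (y : ℝ) : ℝ := deriv (cdf (P.map M.Y)) y

/-- `q_τ = Q_τ(F_Y)`. -/
def qY (M : TriangularModel Ω E k) (P : Measure Ω) (τ : ℝ) : ℝ := quantile (cdf (P.map M.Y)) τ

/-- Regularity of the outcome and of its response to the policy. Smoothness and positivity in the
outcome variable are only required on the interior of its support: demanding positive densities up
to the endpoints of a compact support would conflict with the dominated joint densities below. -/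
structure OutcomeRegular (M : TriangularModel Ω E k) (P : Measure Ω) : Prop where
  contDiff_cdf : ContDiffOn ℝ 1 (cdf (P.map M.Y)) (interior (M.suppY P))
  density_pos : ∀ y ∈ interior (M.suppY P), 0 < M.fY P y
  expansion : ∀ ν : ℝ, 0 < ν →
    (fun t : ℝ => P.real {ω | ν * t ≤
      |M.m (M.policy t (M.D ω)) (M.X ω) (M.ε ω) - M.m (M.D ω) (M.X ω) (M.ε ω)
        - t * M.mDot (M.D ω) (M.X ω) (M.ε ω)|}) =o[𝓝[>] 0] fun t : ℝ => t
  joint_density : ∃ f : ℝ → ℝ → ℝ, Measurable (Function.uncurry f) ∧ (∀ y y', 0 ≤ f y y') ∧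
    P.map (fun ω => (M.Y ω, M.mDot (M.D ω) (M.X ω) (M.ε ω))) =
      (volume : Measure (ℝ × ℝ)).withDensity (fun p => ENNReal.ofReal (f p.1 p.2)) ∧
    (∀ y', ContinuousOn (fun y => f y y') (interior (M.suppY P))) ∧
    ∃ (g : ℝ → ℝ) (C : ℝ), Integrable g ∧ Integrable (fun y' => y' * g y') ∧ 0 < C ∧
      ∀ y y', f y y' ≤ C * |g y'|

/-- The conditions under which `V` is a control variable: `(ε, η)` is independent of `Z` given `X`,
the selection equation is strictly monotonic in `η`, and the conditional CDF of `η` given `X` is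
continuous and strictly increasing on its support. -/
structure ControlConditions [StandardBorelSpace Ω] (M : TriangularModel Ω E k) (P : Measure Ω)
    [IsFiniteMeasure P] : Prop where
  condIndep : CondIndepFun (MeasurableSpace.comap M.X inferInstance) M.measurable_X.comap_le
    (fun ω => (M.ε ω, M.η ω)) M.Z P
  monotonic :
    (∀ᵐ ω ∂P, StrictMonoOn (M.h (M.Z ω) (M.X ω)) (P.map M.η).support) ∨
    (∀ᵐ ω ∂P, StrictAntiOn (M.h (M.Z ω) (M.X ω)) (P.map M.η).support)
  cdf_η : ∀ᵐ x ∂(P.map M.X), Continuous (cdf (condDistrib M.η M.X P x)) ∧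
    StrictMonoOn (cdf (condDistrib M.η M.X P x)) (condDistrib M.η M.X P x).support

section Conditional

/- Below, `K` is a regular conditional distribution of `ε` given `(D, V, X)`. Since
`Y = m(D, X, ε)`, the conditional law of `Y` given `(D, V, X) = (d, v, x)` is the image of
`K (d, v, x)` under `m(d, x, ·)`. -/

/-- The conditional law of `Y` given `(D, V, X) = (d, v, x)`. -/
def condLawY (M : TriangularModel Ω E k) (K : Kernel (ℝ × ℝ × Covariates k) E) (d v : ℝ)
    (x : Covariates k) : Measure ℝ :=
  (K (d, v, x)).map (M.m d x)

/-- The conditional CDF `F_{Y|D,V,X}(y | d, v, x)`. -/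
def condCdfY (M : TriangularModel Ω E k) (K : Kernel (ℝ × ℝ × Covariates k) E) (y d v : ℝ)
    (x : Covariates k) : ℝ :=
  cdf (M.condLawY K d v x) y

/-- The conditional density `f_{Y|D,V,X}(y | d, v, x)`, as the derivative of the CDF in `y`. -/
def condDensityY (M : TriangularModel Ω E k) (K : Kernel (ℝ × ℝ × Covariates k) E) (y d v : ℝ)
    (x : Covariates k) : ℝ :=
  deriv (fun y' => M.condCdfY K y' d v x) y

/-- The conditional support of `Y` given `(D, V, X) = (d, v, x)`. -/
def condSuppY (M : TriangularModel Ω E k) (K : Kernel (ℝ × ℝ × Covariates k) E) (d v : ℝ)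
    (x : Covariates k) : Set ℝ :=
  (M.condLawY K d v x).support

/-- The conditional quantile `Q_{Y|D,V,X}(α | d, v, x)`. -/
def condQuantileY (M : TriangularModel Ω E k) (K : Kernel (ℝ × ℝ × Covariates k) E) (α d v : ℝ)
    (x : Covariates k) : ℝ :=
  quantile (fun y => M.condCdfY K y d v x) α

/-- The partial derivative `∂_d F_{Y|D,V,X}(y | d, v, x)`; conditioning on `D = d` is meaningful
for `d` in the support of `D`. -/
def dCondCdfY (M : TriangularModel Ω E k) (P : Measure Ω) (K : Kernel (ℝ × ℝ × Covariates k) E)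
    (y d v : ℝ) (x : Covariates k) : ℝ :=
  derivWithin (fun d' => M.condCdfY K y d' v x) (M.suppD P) d

/-- The conditional quantile derivative `β^CQD(α, d, v, x) = ∂_d Q_{Y|D,V,X}(α | d, v, x)`. -/
def betaCQD (M : TriangularModel Ω E k) (P : Measure Ω) (K : Kernel (ℝ × ℝ × Covariates k) E)
    (α d v : ℝ) (x : Covariates k) : ℝ :=
  derivWithin (fun d' => M.condQuantileY K α d' v x) (M.suppD P) d

/-- The set `{α ∈ (0,1) : Q_{Y|D,V,X}(α | d, v, x) = q_τ}`. -/
def matchingSet (M : TriangularModel Ω E k) (P : Measure Ω) (K : Kernel (ℝ × ℝ × Covariates k) E)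
    (τ d v : ℝ) (x : Covariates k) : Set ℝ :=
  {α | α ∈ Ioo (0 : ℝ) 1 ∧ M.condQuantileY K α d v x = M.qY P τ}

/-- The matching function `ζ_τ(d, v, x)`: the element of the matching set when that set is a
singleton. -/
def zeta (M : TriangularModel Ω E k) (P : Measure Ω) (K : Kernel (ℝ × ℝ × Covariates k) E)
    (τ d v : ℝ) (x : Covariates k) : ℝ :=
  sSup (M.matchingSet P K τ d v x)

/-- The weight `ω_y(d, v, x) = f_{Y|D,V,X}(y | d, v, x) / f_Y(y)`. -/
def weight (M : TriangularModel Ω E k) (P : Measure Ω) (K : Kernel (ℝ × ℝ × Covariates k) E)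
    (y d v : ℝ) (x : Covariates k) : ℝ :=
  M.condDensityY K y d v x / M.fY P y

/-- `(d, v, x)` lies in `supp D × supp V × supp X`. -/
def InSupports (M : TriangularModel Ω E k) (P : Measure Ω) [IsFiniteMeasure P] (d v : ℝ)
    (x : Covariates k) : Prop :=
  d ∈ M.suppD P ∧ v ∈ (P.map (M.V P)).support ∧ x ∈ (P.map M.X).support

/-- Regularity of the conditional distributions given `(D, V, X)`, for each
`(d, v, x) ∈ supp D × supp V × supp X`; the dominating function does not depend on `(d, v, x)`.
Smoothness in `d` is that of the conditional CDF and of its inverse, the conditional quantile. -/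
structure ConditionalRegular (M : TriangularModel Ω E k) (P : Measure Ω) [IsFiniteMeasure P]
    (K : Kernel (ℝ × ℝ × Covariates k) E) : Prop where
  absolutelyContinuous : ∀ d v x, M.InSupports P d v x → M.condLawY K d v x ≪ volume
  density_pos : ∀ d v x, M.InSupports P d v x →
    ∀ y ∈ interior (M.condSuppY K d v x), 0 < M.condDensityY K y d v x
  density_bounded : ∀ d v x, M.InSupports P d v x →
    ∃ B : ℝ, ∀ y ∈ interior (M.condSuppY K d v x), M.condDensityY K y d v x ≤ B
  density_continuous : ∀ d v x, M.InSupports P d v x →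
    ContinuousOn (fun y => M.condDensityY K y d v x) (interior (M.condSuppY K d v x))
  contDiff_condCdf : ∀ v ∈ (P.map (M.V P)).support, ∀ x ∈ (P.map M.X).support, ∀ y : ℝ,
    ContDiffOn ℝ 1 (fun d => M.condCdfY K y d v x) (M.suppD P)
  differentiable_condQuantile : ∀ v ∈ (P.map (M.V P)).support, ∀ x ∈ (P.map M.X).support,
    ∀ α ∈ Ioo (0 : ℝ) 1, DifferentiableOn ℝ (fun d => M.condQuantileY K α d v x) (M.suppD P)
  expansion : ∀ d v x, M.InSupports P d v x → ∀ ν : ℝ, 0 < ν →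
    (fun δ : ℝ => (K (d, v, x)).real
      {e | ν * δ ≤ |M.m (d + δ) x e - M.m d x e - δ * M.dm d x e|}) =o[𝓝[>] 0] fun δ : ℝ => δ
  joint_density : ∃ (g : ℝ → ℝ) (C : ℝ), Integrable g ∧ Integrable (fun y' => y' * g y') ∧ 0 < C ∧
    ∀ d v x, M.InSupports P d v x →
      ∃ f : ℝ → ℝ → ℝ, Measurable (Function.uncurry f) ∧ (∀ y y', 0 ≤ f y y') ∧
        (K (d, v, x)).map (fun e => (M.m d x e, M.dm d x e)) =
          (volume : Measure (ℝ × ℝ)).withDensity (fun p => ENNReal.ofReal (f p.1 p.2)) ∧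
        (∀ y', ContinuousOn (fun y => f y y') (interior (M.condSuppY K d v x))) ∧
        ∀ y y', f y y' ≤ C * |g y'|

end Conditional

end TriangularModel

/-- `κ` is the regular conditional distribution of `W` given `Y`, in the version that is weakly
continuous on `s`; when every non-empty relatively open subset of `s` has positive probability
under the law of `Y`, the value of `κ` at each point of `s` is thereby determined. -/
def IsContinuousCondDistrib {Ω T : Type*} [MeasurableSpace Ω] [TopologicalSpace T]
    [MeasurableSpace T] (P : Measure Ω) (W : Ω → T) (Y : Ω → ℝ) (s : Set ℝ) (κ : Kernel ℝ T) :
    Prop :=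
  IsMarkovKernel κ ∧ HasCondDistrib W Y κ P ∧
    ∀ φ : T → ℝ, Continuous φ → (∃ B : ℝ, ∀ w, |φ w| ≤ B) →
      ContinuousOn (fun y => ∫ w, φ w ∂(κ y)) s

end

/-! Everything rests on one first-order expansion. If `(U, R)` has joint density `f y y'`,
continuous in `y` and dominated by some `G y'` with a first moment, and `Ut t = U + t R + o(t)` in
probability at rate `o(t)`, then the distribution function of `Ut t` at `y + t s` moves at rate `s A
- B`, where `A = ∫ f y y' dy'` and `B = ∫ y' f y y' dy'` (`DominatedDensity.tendsto_perturbed`).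
Inverting, the quantile at a level attained at `y` moves at rate `B / A`
(`DominatedDensity.tendsto_quantile`).

Applied to `Y` and its policy response, this gives `θ = B₀ / f_Y(q_τ)`, with `B₀` the moment `B` of
the unconditional density. Applied to the conditional law of `ε` given `w = (d, v, x)`, with `d`
perturbed, it gives `∂_d F = -B_w` and `∂_d Q = B_w / A_w`, with `A_w` the conditional density of
`Y`. The second application needs the law of `ε` to stay the same when the conditioning value of `D`
moves with the argument of `m`. That is the role of the control variable: given `(V, X)`, the
disturbance `ε` is independent of `D` (`ae_kernel_eq`). A regular conditional distribution respects
this only almost everywhere, but as `D` has no atoms given `(V, X)`, almost every `d` is a right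
limit of good values `d'`, and a derivative that is assumed to exist can be computed along those
(`ae_frequently_kernel_eq`, `derivWithin_eq_of_frequently`).

The two levels are joined by thin strips: `h⁻¹ E[π̇ ∂_d m; y < Y ≤ y + h]` tends to `B₀` by the
joint density, and to `∫ π̇ B_w` by disintegration and dominated convergence, `G` being the same for
all `w`. This is the first formula. Since `A_w β = B_w`, dividing by `f_Y` gives the second. Strips
restricted to `W ∈ B` show that `ω_y dF_W` is the conditional law of `W` given `Y = y`, weakly
continuous in `y`, which gives the third. Off the conditional support both `A_w` and `B_w` vanish,
and boundary points of that support are excluded almost surely. -/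

/-! ### First-order expansion under a dominated joint density -/

/-- The joint law of `(U, R)` has a density `f y y' ≤ G y'`, where `G` is integrable and has
an integrable first moment. -/
structure DominatedDensity {E : Type*} [MeasurableSpace E] (μ : Measure E) (U R : E → ℝ)
    (f : ℝ → ℝ → ℝ) (G : ℝ → ℝ) : Prop where
  measurable_left : Measurable U
  measurable_right : Measurable R
  measurable_density : Measurable (Function.uncurry f)
  nonneg : ∀ y y', 0 ≤ f y y'
  map_eq : μ.map (fun e => (U e, R e)) =
    (volume : Measure (ℝ × ℝ)).withDensity (fun p => ENNReal.ofReal (f p.1 p.2))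
  le : ∀ y y', f y y' ≤ G y'
  integrable : Integrable G
  integrable_mul : Integrable fun y' => y' * G y'

namespace DominatedDensity

variable {E : Type*} [MeasurableSpace E] {μ : Measure E} {U R : E → ℝ} {f : ℝ → ℝ → ℝ} {G : ℝ → ℝ}

lemma dominating_nonneg (H : DominatedDensity μ U R f G) (y' : ℝ) : 0 ≤ G y' :=
  (H.nonneg 0 y').trans (H.le 0 y')

lemma measurable_section (H : DominatedDensity μ U R f G) (y' : ℝ) :
    Measurable fun y => f y y' :=
  H.measurable_density.comp (measurable_id.prodMk measurable_const)

lemma measurable_section_right (H : DominatedDensity μ U R f G) (y : ℝ) :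
    Measurable fun y' => f y y' :=
  H.measurable_density.comp (measurable_const.prodMk measurable_id)

lemma integrable_section (H : DominatedDensity μ U R f G) (y : ℝ) :
    Integrable fun y' => f y y' :=
  H.integrable.mono' (H.measurable_section_right y).aestronglyMeasurable
    (.of_forall fun y' => by rw [Real.norm_of_nonneg (H.nonneg _ _)]; exact H.le _ _)

lemma integrable_mul_section (H : DominatedDensity μ U R f G) (y : ℝ) :
    Integrable fun y' => y' * f y y' :=
  H.integrable_mul.mono (measurable_id.mul (H.measurable_section_right y)).aestronglyMeasurable
    (.of_forall fun y' => by
      rw [norm_mul, norm_mul, Real.norm_of_nonneg (H.nonneg _ _),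
        Real.norm_of_nonneg (H.dominating_nonneg _)]
      exact mul_le_mul_of_nonneg_left (H.le _ _) (norm_nonneg _))

lemma integrable_density [IsFiniteMeasure μ] (H : DominatedDensity μ U R f G) :
    Integrable (fun p : ℝ × ℝ => f p.1 p.2) := by
  refine ⟨H.measurable_density.aestronglyMeasurable, ?_⟩
  rw [hasFiniteIntegral_iff_ofReal (.of_forall fun p => H.nonneg _ _), ← setLIntegral_univ,
    ← withDensity_apply _ MeasurableSet.univ, ← H.map_eq]
  exact measure_lt_top _ _

/-- The variable of `R` is kept outside so that `G` can dominate after the inner integration in `u`.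
-/
lemma setIntegral_eq (H : DominatedDensity μ U R f G) {s : Set (ℝ × ℝ)} (hs : MeasurableSet s)
    {φ : ℝ → ℝ} (hφ : Measurable φ)
    (hi : Integrable (s.indicator fun p : ℝ × ℝ => f p.1 p.2 * φ p.2)) :
    ∫ e in (fun e => (U e, R e)) ⁻¹' s, φ (R e) ∂μ =
      ∫ y', ∫ u, s.indicator (fun p : ℝ × ℝ => f p.1 p.2 * φ p.2) (u, y') := by
  have hm : Measurable fun e => (U e, R e) := H.measurable_left.prodMk H.measurable_right
  have h1 : ∫ e in (fun e => (U e, R e)) ⁻¹' s, φ (R e) ∂μ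
      = ∫ p in s, φ p.2 ∂(μ.map fun e => (U e, R e)) := by
    rw [setIntegral_map hs _ hm.aemeasurable]
    exact (hφ.comp measurable_snd).aestronglyMeasurable
  have hd : Measurable fun p : ℝ × ℝ => ENNReal.ofReal (f p.1 p.2) :=
    H.measurable_density.ennreal_ofReal
  rw [h1, H.map_eq, setIntegral_withDensity_eq_setIntegral_toReal_smul hd
    (.of_forall fun _ => ENNReal.ofReal_lt_top) _ hs, ← integral_indicator hs]
  rw [← integral_prod_symm _ hi]
  refine integral_congr_ae (.of_forall fun p => ?_)
  by_cases hp : p ∈ s <;> simp [hp, H.nonneg]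

lemma measureReal_eq [IsFiniteMeasure μ] (H : DominatedDensity μ U R f G) {s : Set (ℝ × ℝ)}
    (hs : MeasurableSet s) :
    μ.real ((fun e => (U e, R e)) ⁻¹' s) =
      ∫ y', ∫ u, s.indicator (fun p : ℝ × ℝ => f p.1 p.2) (u, y') := by
  have := H.setIntegral_eq hs (φ := fun _ => 1) measurable_const
    (by simpa using H.integrable_density.indicator hs)
  simpa using this

lemma integrable_strip (H : DominatedDensity μ U R f G) {φ : ℝ → ℝ} (hφ : Measurable φ)
    (hG : Integrable fun y' => φ y' * G y') (y z : ℝ) :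
    Integrable ((Ioc y z ×ˢ (univ : Set ℝ)).indicator fun p : ℝ × ℝ => f p.1 p.2 * φ p.2) := by
  have hs : MeasurableSet (Ioc y z ×ˢ (univ : Set ℝ)) := measurableSet_Ioc.prod .univ
  have hdom : Integrable fun p : ℝ × ℝ =>
      (Ioc y z).indicator (fun _ => (1 : ℝ)) p.1 * (φ p.2 * G p.2) :=
    Integrable.mul_prod ((integrable_indicator_iff measurableSet_Ioc).2 (by simp)) hG
  refine hdom.mono ((H.measurable_density.mul
    (hφ.comp measurable_snd)).indicator hs).aestronglyMeasurable (.of_forall fun p => ?_)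
  by_cases hp : p.1 ∈ Ioc y z
  · rw [indicator_of_mem (by exact ⟨hp, trivial⟩), indicator_of_mem hp, one_mul, norm_mul,
      norm_mul, mul_comm, Real.norm_of_nonneg (H.nonneg _ _),
      Real.norm_of_nonneg (H.dominating_nonneg _)]
    exact mul_le_mul_of_nonneg_left (H.le _ _) (norm_nonneg _)
  · rw [indicator_of_notMem (fun h => hp h.1), norm_zero]
    exact norm_nonneg _

lemma integrableOn_strip (H : DominatedDensity μ U R f G) {φ : ℝ → ℝ} (hφ : Measurable φ)
    (hG : Integrable fun y' => φ y' * G y') (y z : ℝ) :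
    IntegrableOn (fun e => φ (R e)) (U ⁻¹' Ioc y z) μ := by
  have hs : MeasurableSet (Ioc y z ×ˢ (univ : Set ℝ)) := measurableSet_Ioc.prod .univ
  have hd : Measurable fun p : ℝ × ℝ => ENNReal.ofReal (f p.1 p.2) :=
    H.measurable_density.ennreal_ofReal
  have h1 : Integrable ((Ioc y z ×ˢ (univ : Set ℝ)).indicator fun p : ℝ × ℝ => φ p.2)
      (μ.map fun e => (U e, R e)) := by
    rw [H.map_eq, integrable_withDensity_iff_integrable_smul' hd
      (.of_forall fun _ => ENNReal.ofReal_lt_top)]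
    refine (H.integrable_strip hφ hG y z).congr (.of_forall fun p => ?_)
    by_cases hp : p ∈ Ioc y z ×ˢ (univ : Set ℝ)
    · simp only [indicator_of_mem hp, ENNReal.toReal_ofReal (H.nonneg _ _), smul_eq_mul]
    · simp only [indicator_of_notMem hp, smul_zero]
  rw [← integrable_indicator_iff (H.measurable_left measurableSet_Ioc)]
  refine (h1.comp_measurable (H.measurable_left.prodMk H.measurable_right)).congr
    (.of_forall fun e => ?_)
  by_cases he : U e ∈ Ioc y z
  · rw [indicator_of_mem (show e ∈ U ⁻¹' Ioc y z from he)]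
    exact indicator_of_mem (show (U e, R e) ∈ Ioc y z ×ˢ (univ : Set ℝ) from ⟨he, trivial⟩) _
  · rw [indicator_of_notMem (show e ∉ U ⁻¹' Ioc y z from he)]
    exact indicator_of_notMem (fun h => he h.1) _

/-- Integrals over thin strips. -/
lemma strip_eq (H : DominatedDensity μ U R f G) {φ : ℝ → ℝ} (hφ : Measurable φ)
    (hG : Integrable fun y' => φ y' * G y') (y h : ℝ) (hh : 0 ≤ h) :
    ∫ e in U ⁻¹' Ioc y (y + h), φ (R e) ∂μ = ∫ y', φ y' * ∫ u in y..(y + h), f u y' := by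
  have h1 := H.setIntegral_eq (measurableSet_Ioc.prod .univ) hφ (H.integrable_strip hφ hG y (y + h))
  have h2 : (fun e => (U e, R e)) ⁻¹' (Ioc y (y + h) ×ˢ (univ : Set ℝ)) = U ⁻¹' Ioc y (y + h) := by
    ext e
    simp
  rw [h2] at h1
  rw [h1]
  refine integral_congr_ae (.of_forall fun y' => ?_)
  have h3 : (fun u => (Ioc y (y + h) ×ˢ (univ : Set ℝ)).indicator
      (fun p : ℝ × ℝ => f p.1 p.2 * φ p.2) (u, y'))
      = (Ioc y (y + h)).indicator fun u => f u y' * φ y' := by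
    ext u
    by_cases hu : u ∈ Ioc y (y + h)
    · rw [indicator_of_mem hu, indicator_of_mem (by exact ⟨hu, trivial⟩)]
    · rw [indicator_of_notMem hu, indicator_of_notMem (fun h => hu h.1)]
  simp only
  rw [h3, integral_indicator measurableSet_Ioc, intervalIntegral.integral_of_le (by linarith),
    integral_mul_const, mul_comm]

lemma abs_intervalIntegral_le (H : DominatedDensity μ U R f G) (y z y' : ℝ) :
    |∫ u in y..z, f u y'| ≤ G y' * |z - y| := by
  rw [← Real.norm_eq_abs]
  refine intervalIntegral.norm_integral_le_of_norm_le_const fun u _ => ?_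
  rw [Real.norm_of_nonneg (H.nonneg _ _)]
  exact H.le _ _

/-- The upper endpoint may move with `y'`, as it does in the linear perturbation. -/
lemma measurable_intervalIntegral (H : DominatedDensity μ U R f G) (y : ℝ) {b : ℝ → ℝ}
    (hb : Measurable b) : AEStronglyMeasurable (fun y' => ∫ u in y..b y', f u y') := by
  simp only [intervalIntegral.intervalIntegral_eq_integral_uIoc]
  have h1 : StronglyMeasurable fun y' => ∫ u in uIoc y (b y'), f u y' := by
    have : (fun y' => ∫ u in uIoc y (b y'), f u y')
        = fun y' => ∫ u, {p : ℝ × ℝ | p.2 ∈ uIoc y (b p.1)}.indicator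
          (fun p => f p.2 p.1) (y', u) := by
      ext y'
      rw [← integral_indicator measurableSet_uIoc]
      rfl
    rw [this]
    refine StronglyMeasurable.integral_prod_right'
      (f := {p : ℝ × ℝ | p.2 ∈ uIoc y (b p.1)}.indicator (fun p => f p.2 p.1)) ?_
    refine (Measurable.indicator (H.measurable_density.comp measurable_swap) ?_).stronglyMeasurable
    simp only [uIoc, mem_Ioc]
    exact (measurableSet_lt (measurable_const.min (hb.comp measurable_fst)) measurable_snd).inter
      (measurableSet_le measurable_snd (measurable_const.max (hb.comp measurable_fst)))
  -- The orientation sign of the interval integral.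
  have h2 : Measurable fun y' => if y ≤ b y' then (1 : ℝ) else -1 :=
    Measurable.ite (measurableSet_le measurable_const hb) measurable_const measurable_const
  exact h2.aestronglyMeasurable.smul h1.aestronglyMeasurable

lemma strip_bound (H : DominatedDensity μ U R f G) {φ : ℝ → ℝ} (hφ : Measurable φ)
    (hG : Integrable fun y' => φ y' * G y') (y h : ℝ) (hh : 0 < h) :
    |h⁻¹ * ∫ e in U ⁻¹' Ioc y (y + h), φ (R e) ∂μ| ≤ ∫ y', |φ y' * G y'| := by
  rw [H.strip_eq hφ hG y h hh.le, ← integral_const_mul]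
  simp only [← Real.norm_eq_abs]
  refine norm_integral_le_of_norm_le hG.norm (.of_forall fun y' => ?_)
  have h1 := H.abs_intervalIntegral_le y (y + h) y'
  rw [add_sub_cancel_left, abs_of_pos hh] at h1
  rw [norm_mul, norm_mul, norm_mul, norm_inv, Real.norm_of_nonneg hh.le,
    Real.norm_of_nonneg (H.dominating_nonneg y')]
  calc h⁻¹ * (‖φ y'‖ * ‖∫ u in y..(y + h), f u y'‖) ≤ h⁻¹ * (‖φ y'‖ * (G y' * h)) := by
        gcongr; exact h1
    _ = ‖φ y'‖ * G y' := by field_simp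

lemma tendsto_average (H : DominatedDensity μ U R f G) {y y' : ℝ}
    (hy : ContinuousAt (fun u => f u y') y) (c : ℝ) :
    Tendsto (fun t : ℝ => t⁻¹ * ∫ u in y..(y + t * c), f u y') (𝓝[>] 0) (𝓝 (c * f y y')) := by
  have h1 : HasDerivAt (fun z => ∫ u in y..z, f u y') (f y y') (y + 0 * c) := by
    rw [zero_mul, add_zero]
    exact intervalIntegral.integral_hasDerivAt_right (by simp)
      (H.measurable_section y').stronglyMeasurable.stronglyMeasurableAtFilter hy
  have h2 : HasDerivAt (fun t : ℝ => y + t * c) c 0 := by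
    simpa using ((hasDerivAt_id (0 : ℝ)).mul_const c).const_add y
  have h3 := (h1.comp 0 h2).tendsto_slope_zero_right
  simpa [mul_comm] using h3

lemma tendsto_strip (H : DominatedDensity μ U R f G) {φ : ℝ → ℝ} (hφ : Measurable φ)
    (hG : Integrable fun y' => φ y' * G y') {y : ℝ}
    (hy : ∀ y', ContinuousAt (fun u => f u y') y) :
    Tendsto (fun h : ℝ => h⁻¹ * ∫ e in U ⁻¹' Ioc y (y + h), φ (R e) ∂μ) (𝓝[>] 0)
      (𝓝 (∫ y', φ y' * f y y')) := by
  have key : Tendsto (fun h : ℝ => ∫ y', φ y' * (h⁻¹ * ∫ u in y..(y + h), f u y')) (𝓝[>] 0)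
      (𝓝 (∫ y', φ y' * f y y')) := by
    refine tendsto_integral_filter_of_dominated_convergence (fun y' => |φ y' * G y'|) ?_ ?_
      hG.abs ?_
    · exact .of_forall fun h => hφ.aestronglyMeasurable.mul
        ((H.measurable_intervalIntegral y measurable_const).const_mul _)
    · filter_upwards [self_mem_nhdsWithin] with h hh
      refine .of_forall fun y' => ?_
      have h1 := H.abs_intervalIntegral_le y (y + h) y'
      have hh' : (0 : ℝ) < h := hh
      rw [add_sub_cancel_left, abs_of_pos hh'] at h1
      rw [norm_mul, norm_mul, norm_inv, Real.norm_of_nonneg hh'.le, abs_mul,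
        abs_of_nonneg (H.dominating_nonneg y')]
      refine mul_le_mul_of_nonneg_left ?_ (norm_nonneg _)
      rw [inv_mul_le_iff₀ hh', mul_comm]
      exact h1
    · refine .of_forall fun y' => ?_
      have := H.tendsto_average (hy y') 1
      simpa using this.const_mul (φ y')
  refine key.congr' ?_
  filter_upwards [self_mem_nhdsWithin] with h hh
  have hh' : (0 : ℝ) < h := hh
  rw [H.strip_eq hφ hG y h hh'.le, ← integral_const_mul]
  congr 1; ext y'; ring

/-- For fixed `y'` the event `u + t y' ≤ y + t c` is the half-line ending at `y + t (c - y')`, and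
`t = 0` gives the half-line ending at `y`. -/
lemma measureReal_linear_sub [IsFiniteMeasure μ] (H : DominatedDensity μ U R f G) (y t c : ℝ) :
    μ.real {e | U e + t * R e ≤ y + t * c} - μ.real {e | U e ≤ y} =
      ∫ y', ∫ u in y..(y + t * (c - y')), f u y' := by
  have hs : ∀ t : ℝ, MeasurableSet {p : ℝ × ℝ | p.1 + t * p.2 ≤ y + t * c} := fun t =>
    measurableSet_le (by fun_prop) (by fun_prop)
  have hset : ∀ t : ℝ, μ.real {e | U e + t * R e ≤ y + t * c} =
      ∫ y', ∫ u, {p : ℝ × ℝ | p.1 + t * p.2 ≤ y + t * c}.indicator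
        (fun p : ℝ × ℝ => f p.1 p.2) (u, y') := fun t => H.measureReal_eq (hs t)
  have h0 := hset 0
  simp only [zero_mul, add_zero] at h0
  rw [hset t, h0]
  have hint := fun t => (H.integrable_density.indicator (hs t)).integral_prod_right
  have hi0 := hint 0
  simp only [zero_mul, add_zero] at hi0
  rw [← integral_sub (hint t) hi0]
  have hae : ∀ᵐ y' : ℝ, Integrable fun u => f u y' := H.integrable_density.prod_left_ae
  refine integral_congr_ae ?_
  filter_upwards [hae] with y' hy'
  have hI : ∀ t : ℝ, ∫ u, {p : ℝ × ℝ | p.1 + t * p.2 ≤ y + t * c}.indicator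
        (fun p : ℝ × ℝ => f p.1 p.2) (u, y') = ∫ u in Iic (y + t * (c - y')), f u y' := by
    intro t
    rw [← integral_indicator measurableSet_Iic]
    congr 1; ext u
    have : (u, y') ∈ {p : ℝ × ℝ | p.1 + t * p.2 ≤ y + t * c} ↔ u ∈ Iic (y + t * (c - y')) := by
      simp only [mem_ofPred_eq, mem_Iic]; constructor <;> intro h <;> linarith
    by_cases hu : u ∈ Iic (y + t * (c - y'))
    · rw [indicator_of_mem hu, indicator_of_mem (this.2 hu)]
    · rw [indicator_of_notMem hu, indicator_of_notMem (fun h => hu (this.1 h))]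
  have hI0 := hI 0
  simp only [zero_mul, add_zero] at hI0
  rw [hI t, hI0, intervalIntegral.integral_Iic_sub_Iic hy'.integrableOn hy'.integrableOn]

/-- The inner integral runs over an interval of signed length `t (c - y')`, so after division by `t`
it tends to `(c - y') f y y'` under the bound `|c - y'| G y'`; hence the first moment required of
`G`. -/
lemma tendsto_linear [IsFiniteMeasure μ] (H : DominatedDensity μ U R f G) {y : ℝ}
    (hy : ∀ y', ContinuousAt (fun u => f u y') y) (c : ℝ) :
    Tendsto (fun t : ℝ => t⁻¹ * (μ.real {e | U e + t * R e ≤ y + t * c} - μ.real {e | U e ≤ y}))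
      (𝓝[>] 0) (𝓝 (c * (∫ y', f y y') - ∫ y', y' * f y y')) := by
  have hlim : c * (∫ y', f y y') - ∫ y', y' * f y y' = ∫ y', (c - y') * f y y' := by
    rw [← integral_const_mul, ← integral_sub ((H.integrable_section y).const_mul c)
      (H.integrable_mul_section y)]
    congr 1; ext; ring
  have hG : Integrable fun y' => (c - y') * G y' := by
    refine ((H.integrable.const_mul c).sub H.integrable_mul).congr (.of_forall fun y' => ?_)
    simp only [Pi.sub_apply]; ring
  rw [hlim]
  simp only [H.measureReal_linear_sub, ← integral_const_mul]
  refine tendsto_integral_filter_of_dominated_convergence (fun y' => |(c - y') * G y'|) ?_ ?_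
      hG.abs ?_
  · exact .of_forall fun t => (H.measurable_intervalIntegral y (by fun_prop)).const_mul _
  · filter_upwards [self_mem_nhdsWithin] with t ht
    refine .of_forall fun y' => ?_
    have ht' : (0 : ℝ) < t := ht
    have h1 := H.abs_intervalIntegral_le y (y + t * (c - y')) y'
    rw [add_sub_cancel_left, abs_mul, abs_of_pos ht'] at h1
    rw [norm_mul, norm_inv, Real.norm_of_nonneg ht'.le, abs_mul,
      abs_of_nonneg (H.dominating_nonneg y'), inv_mul_le_iff₀ ht']
    exact h1.trans (le_of_eq (by ring))
  · exact .of_forall fun y' => H.tendsto_average (hy y') (c - y')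

/-- The distribution function of a perturbation `U + t R + o(t)` of `U`, to first order. -/
lemma tendsto_perturbed [IsFiniteMeasure μ] (H : DominatedDensity μ U R f G) {y : ℝ}
    (hy : ∀ y', ContinuousAt (fun u => f u y') y) {Ut : ℝ → E → ℝ}
    (hexp : ∀ ν : ℝ, 0 < ν →
      (fun t : ℝ => μ.real {e | ν * t ≤ |Ut t e - U e - t * R e|}) =o[𝓝[>] 0] fun t : ℝ => t)
    (s : ℝ) :
    Tendsto (fun t : ℝ => t⁻¹ * (μ.real {e | Ut t e ≤ y + t * s} - μ.real {e | U e ≤ y}))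
      (𝓝[>] 0) (𝓝 (s * (∫ y', f y y') - ∫ y', y' * f y y')) := by
  set A := ∫ y', f y y' with hA
  set B := ∫ y', y' * f y y' with hB
  have hA0 : 0 ≤ A := integral_nonneg fun y' => H.nonneg _ _
  rw [Metric.tendsto_nhds]
  intro r hr
  -- Off the event `Bd`, replacing `Ut t` by `U + t R` costs a shift of `s` by at most `ν`, which
  -- changes the limit by `ν A`. The error `r` is split between this shift, the linear limit and the
  -- probability of `Bd`.
  obtain ⟨ν, hν, hνA⟩ : ∃ ν : ℝ, 0 < ν ∧ ν * A < r / 3 := by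
    refine ⟨r / 3 / (A + 1), by positivity, ?_⟩
    rw [div_mul_eq_mul_div, div_lt_iff₀ (by positivity)]
    nlinarith
  have hup := Metric.tendsto_nhds.1 (H.tendsto_linear hy (s + ν)) (r / 3) (by positivity)
  have hlo := Metric.tendsto_nhds.1 (H.tendsto_linear hy (s - ν)) (r / 3) (by positivity)
  have hsm := (hexp ν hν).def (show (0 : ℝ) < r / 3 by positivity)
  filter_upwards [hup, hlo, hsm, self_mem_nhdsWithin] with t h1 h2 h3 ht
  have ht' : (0 : ℝ) < t := ht
  rw [Real.dist_eq, abs_lt] at h1 h2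
  rw [Real.dist_eq, abs_lt]
  rw [Real.norm_of_nonneg measureReal_nonneg, Real.norm_of_nonneg ht'.le] at h3
  set Bd := {e | ν * t ≤ |Ut t e - U e - t * R e|} with hBd
  have hu : μ.real {e | Ut t e ≤ y + t * s} ≤
      μ.real {e | U e + t * R e ≤ y + t * (s + ν)} + μ.real Bd := by
    refine (measureReal_mono ?_).trans (measureReal_union_le _ _)
    intro e he
    by_cases hb : e ∈ Bd
    · exact Or.inr hb
    · left
      simp only [hBd, mem_ofPred_eq, not_le, abs_lt] at hb he ⊢
      nlinarith [hb.1, hb.2]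
  have hl : μ.real {e | U e + t * R e ≤ y + t * (s - ν)} ≤
      μ.real {e | Ut t e ≤ y + t * s} + μ.real Bd := by
    refine (measureReal_mono ?_).trans (measureReal_union_le _ _)
    intro e he
    by_cases hb : e ∈ Bd
    · exact Or.inr hb
    · left
      simp only [hBd, mem_ofPred_eq, not_le, abs_lt] at hb he ⊢
      nlinarith [hb.1, hb.2]
  have h3' : t⁻¹ * μ.real Bd ≤ r / 3 := by
    rw [inv_mul_le_iff₀ ht']; linarith
  have hti : 0 < t⁻¹ := inv_pos.2 ht'
  constructor
  · nlinarith [mul_le_mul_of_nonneg_left hl hti.le, h2.1]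
  · nlinarith [mul_le_mul_of_nonneg_left hu hti.le, h1.2]

end DominatedDensity

/-! ### Quantiles and distribution functions -/

lemma quantile_le_of_le {F : ℝ → ℝ} {τ y : ℝ} (hbot : Tendsto F atBot (𝓝 0)) (hF : Monotone F)
    (hτ : 0 < τ) (h : τ ≤ F y) : quantile F τ ≤ y := by
  refine csInf_le ?_ h
  obtain ⟨z, hz⟩ := (hbot.eventually (gt_mem_nhds hτ)).exists
  exact ⟨z, fun w hw => by
    by_contra hlt
    exact absurd (hF (not_le.1 hlt).le) (not_le.2 (hz.trans_le hw))⟩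

lemma le_quantile_of_lt {F : ℝ → ℝ} {τ y : ℝ} (htop : Tendsto F atTop (𝓝 1)) (hF : Monotone F)
    (hτ : τ < 1) (h : F y < τ) : y ≤ quantile F τ := by
  refine le_csInf ?_ fun z hz => ?_
  · obtain ⟨z, hz⟩ := (htop.eventually (lt_mem_nhds hτ)).exists
    exact ⟨z, hz.le⟩
  · by_contra hlt
    exact absurd (hF (not_le.1 hlt).le) (not_le.2 (h.trans_le hz))

/-- If `s' A < B`, the perturbed distribution function at `y + t s'` is eventually below `τ`, so the
quantile is at least `y + t s'`; symmetrically for `s' A > B`. Only monotonicity of the perturbed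
distribution functions is used. -/
lemma DominatedDensity.tendsto_quantile {E : Type*} [MeasurableSpace E] {μ : Measure E}
    [IsProbabilityMeasure μ] {U R : E → ℝ} {f : ℝ → ℝ → ℝ} {G : ℝ → ℝ}
    (H : DominatedDensity μ U R f G) {y : ℝ}
    (hy : ∀ y', ContinuousAt (fun u => f u y') y) {Ut : ℝ → E → ℝ}
    (hexp : ∀ ν : ℝ, 0 < ν →
      (fun t : ℝ => μ.real {e | ν * t ≤ |Ut t e - U e - t * R e|}) =o[𝓝[>] 0] fun t : ℝ => t)
    (hm : ∀ᶠ t in 𝓝[>] (0 : ℝ), Measurable (Ut t)) {τ : ℝ} (hτ : τ ∈ Ioo (0 : ℝ) 1)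
    (hU : cdf (μ.map U) y = τ) (hpos : 0 < ∫ y', f y y') :
    Tendsto (fun t : ℝ => t⁻¹ * (quantile (cdf (μ.map (Ut t))) τ - y)) (𝓝[>] 0)
      (𝓝 ((∫ y', y' * f y y') / ∫ y', f y y')) := by
  set A := ∫ y', f y y' with hA
  set B := ∫ y', y' * f y y' with hB
  have hcdf : ∀ V : E → ℝ, Measurable V → ∀ z, cdf (μ.map V) z = μ.real {e | V e ≤ z} := by
    intro V hV z
    have := Measure.isProbabilityMeasure_map (μ := μ) hV.aemeasurable
    rw [cdf_eq_real, map_measureReal_apply hV measurableSet_Iic]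
    rfl
  rw [hcdf U H.measurable_left] at hU
  refine tendsto_order.2 ⟨fun s hs => ?_, fun s hs => ?_⟩
  · obtain ⟨s', hs1, hs2⟩ := exists_between hs
    have hlim := H.tendsto_perturbed hy hexp s'
    have hneg : s' * A - B < 0 := by
      rw [lt_div_iff₀ hpos] at hs2; linarith
    filter_upwards [hlim.eventually (gt_mem_nhds hneg), hm, self_mem_nhdsWithin] with t ht hmt ht0
    have ht0' : (0 : ℝ) < t := ht0
    have h1 : cdf (μ.map (Ut t)) (y + t * s') < τ := by
      rw [hcdf _ hmt, ← hU]
      have := neg_of_mul_neg_right ht (inv_pos.2 ht0').le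
      linarith
    have h2 := le_quantile_of_lt (tendsto_cdf_atTop _) (monotone_cdf _) hτ.2 h1
    have h3 : s' ≤ t⁻¹ * (quantile (cdf (μ.map (Ut t))) τ - y) := by
      rw [le_inv_mul_iff₀ ht0']; linarith
    linarith
  · obtain ⟨s', hs1, hs2⟩ := exists_between hs
    have hlim := H.tendsto_perturbed hy hexp s'
    have hneg : 0 < s' * A - B := by
      rw [div_lt_iff₀ hpos] at hs1; linarith
    filter_upwards [hlim.eventually (lt_mem_nhds hneg), hm, self_mem_nhdsWithin] with t ht hmt ht0
    have ht0' : (0 : ℝ) < t := ht0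
    have h1 : τ < cdf (μ.map (Ut t)) (y + t * s') := by
      rw [hcdf _ hmt, ← hU]
      have := pos_of_mul_pos_right ht (inv_pos.2 ht0').le
      linarith
    have h2 := quantile_le_of_le (tendsto_cdf_atBot _) (monotone_cdf _) hτ.1 h1.le
    have h3 : t⁻¹ * (quantile (cdf (μ.map (Ut t))) τ - y) ≤ s' := by
      rw [inv_mul_le_iff₀ ht0']; linarith
    linarith

lemma cdf_map_apply {E : Type*} [MeasurableSpace E] {μ : Measure E} [IsProbabilityMeasure μ]
    {U : E → ℝ} (hU : Measurable U) (y : ℝ) : cdf (μ.map U) y = μ.real {e | U e ≤ y} := by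
  have := Measure.isProbabilityMeasure_map (μ := μ) hU.aemeasurable
  rw [cdf_eq_real, map_measureReal_apply hU measurableSet_Iic]
  rfl

lemma cdf_sub_cdf (μ : Measure ℝ) [IsProbabilityMeasure μ] {y z : ℝ} (h : y ≤ z) :
    cdf μ z - cdf μ y = μ.real (Ioc y z) := by
  rw [cdf_eq_real, cdf_eq_real, ← Iic_sdiff_Iic,
    measureReal_sdiff (Iic_subset_Iic.2 h) measurableSet_Iic]

lemma continuous_cdf (μ : Measure ℝ) [IsProbabilityMeasure μ] [NullSingletonClass μ] :
    Continuous (cdf μ) := by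
  refine continuous_iff_continuousAt.2 fun a => ?_
  rw [(monotone_cdf μ).continuousAt_iff_leftLim_eq_rightLim, (cdf μ).rightLim_eq]
  have h := (cdf μ).measure_singleton a
  rw [measure_cdf, measure_singleton] at h
  have h1 := ENNReal.ofReal_eq_zero.1 h.symm
  exact le_antisymm ((monotone_cdf μ).leftLim_le le_rfl) (by linarith)

lemma cdf_quantile (μ : Measure ℝ) [IsProbabilityMeasure μ] [NullSingletonClass μ] {τ : ℝ}
    (hτ : τ ∈ Ioo (0 : ℝ) 1) : cdf μ (quantile (cdf μ) τ) = τ := by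
  have hc := continuous_cdf μ
  refine le_antisymm ?_ ?_
  · by_contra hlt
    rw [not_le] at hlt
    have h1 : ∀ᶠ y in 𝓝[<] (quantile (cdf μ) τ), τ < cdf μ y :=
      (hc.continuousAt.tendsto.mono_left nhdsWithin_le_nhds).eventually (lt_mem_nhds hlt)
    obtain ⟨y, hy, hy'⟩ := (h1.and self_mem_nhdsWithin).exists
    exact absurd (quantile_le_of_le (tendsto_cdf_atBot μ) (monotone_cdf μ) hτ.1 hy.le)
      (not_le.2 hy')
  · have hcl : IsClosed {y | τ ≤ cdf μ y} := isClosed_le continuous_const hc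
    refine hcl.csInf_mem ?_ ?_
    · obtain ⟨z, hz⟩ := ((tendsto_cdf_atTop μ).eventually (lt_mem_nhds hτ.2)).exists
      exact ⟨z, hz.le⟩
    · obtain ⟨z, hz⟩ := ((tendsto_cdf_atBot μ).eventually (gt_mem_nhds hτ.1)).exists
      exact ⟨z, fun w hw => by
        by_contra hlt
        exact absurd (monotone_cdf μ (not_le.1 hlt).le) (not_le.2 (hz.trans_le hw))⟩

/-- The point `p` may be an endpoint of the interval, where `Ioo y z` is not a neighbourhood of it;
an interior point of the support still has support points inside `Ioo y z` arbitrarily near. -/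
lemma cdf_lt_cdf_of_mem_interior_support (μ : Measure ℝ) [IsProbabilityMeasure μ] {y z p : ℝ}
    (hp : p ∈ interior μ.support) (hyz : y < z) (h : p ∈ Icc y z) : cdf μ y < cdf μ z := by
  have hcl : p ∈ closure (Ioo y z) := by rwa [closure_Ioo hyz.ne]
  obtain ⟨q, hq, hq'⟩ := mem_closure_iff.1 hcl _ isOpen_interior hp
  have hpos : 0 < μ (Ioo y z) :=
    (Measure.mem_support_iff_forall q).1 (interior_subset hq) _ (isOpen_Ioo.mem_nhds hq')
  have h1 := cdf_sub_cdf μ hyz.le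
  have h2 : 0 < μ.real (Ioc y z) :=
    ENNReal.toReal_pos (hpos.trans_le (measure_mono Ioo_subset_Ioc_self)).ne' (measure_ne_top _ _)
  linarith

lemma cdf_mem_Ioo_of_mem_interior_support (μ : Measure ℝ) [IsProbabilityMeasure μ] {y : ℝ}
    (hy : y ∈ interior μ.support) : cdf μ y ∈ Ioo (0 : ℝ) 1 := by
  have h1 := cdf_lt_cdf_of_mem_interior_support μ hy (sub_one_lt y)
    ⟨(sub_one_lt y).le, le_rfl⟩
  have h2 := cdf_lt_cdf_of_mem_interior_support μ hy (lt_add_one y) ⟨le_rfl, (lt_add_one y).le⟩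
  exact ⟨(cdf_nonneg μ _).trans_lt h1, h2.trans_le (cdf_le_one μ _)⟩

lemma quantile_cdf (μ : Measure ℝ) [IsProbabilityMeasure μ] {y : ℝ}
    (hy : y ∈ interior μ.support) : quantile (cdf μ) (cdf μ y) = y := by
  have h01 := cdf_mem_Ioo_of_mem_interior_support μ hy
  refine le_antisymm (quantile_le_of_le (tendsto_cdf_atBot μ) (monotone_cdf μ) h01.1 le_rfl) ?_
  refine le_of_forall_lt fun z hz => ?_
  obtain ⟨w, hw1, hw2⟩ := exists_between hz
  exact hw1.trans_le (le_quantile_of_lt (tendsto_cdf_atTop μ) (monotone_cdf μ) h01.2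
    (cdf_lt_cdf_of_mem_interior_support μ hy hw2 ⟨hw2.le, le_rfl⟩))

lemma setOf_quantile_eq (μ : Measure ℝ) [IsProbabilityMeasure μ] [NullSingletonClass μ] {y : ℝ}
    (hy : y ∈ interior μ.support) :
    {α | α ∈ Ioo (0 : ℝ) 1 ∧ quantile (cdf μ) α = y} = {cdf μ y} := by
  ext α
  simp only [mem_ofPred_eq, mem_singleton_iff]
  constructor
  · rintro ⟨h1, rfl⟩
    exact (cdf_quantile μ h1).symm
  · rintro rfl
    exact ⟨cdf_mem_Ioo_of_mem_interior_support μ hy, quantile_cdf μ hy⟩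

/-- Without atoms the distribution function is `0` at `a` and `1` at `b`, so by continuity a level
strictly between is reached strictly inside. -/
lemma quantile_mem_interior_support (μ : Measure ℝ) [IsProbabilityMeasure μ]
    [NullSingletonClass μ] {a b : ℝ} (hs : μ.support = Icc a b) {τ : ℝ}
    (hτ : τ ∈ Ioo (0 : ℝ) 1) : quantile (cdf μ) τ ∈ interior μ.support := by
  have hq := cdf_quantile μ hτ
  have hfull : μ (Icc a b)ᶜ = 0 := by rw [← hs]; exact Measure.measure_compl_support
  rw [hs, interior_Icc]
  constructor
  · by_contra h
    have h1 : cdf μ a = 0 := by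
      rw [cdf_eq_real, measureReal_def, ENNReal.toReal_eq_zero_iff]
      left
      refine measure_mono_null (t := (Icc a b)ᶜ ∪ {a}) (fun x hx => ?_)
        (measure_union_null hfull (measure_singleton a))
      rcases eq_or_lt_of_le (show x ≤ a from hx) with h | h
      · exact Or.inr h
      · exact Or.inl fun hx' => absurd hx'.1 (not_le.2 h)
    have h2 := monotone_cdf μ (not_lt.1 h)
    linarith [hτ.1]
  · have h1 : cdf μ b = 1 := by
      rw [cdf_eq_real, measureReal_def, (prob_compl_eq_zero_iff measurableSet_Iic).1]
      · simp
      · refine measure_mono_null (t := (Icc a b)ᶜ) (fun x hx hx' => hx hx'.2) hfull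
    have h2 : ∀ᶠ y in 𝓝[<] b, τ < cdf μ y :=
      ((continuous_cdf μ).continuousAt.tendsto.mono_left nhdsWithin_le_nhds).eventually
        (lt_mem_nhds (by rw [h1]; exact hτ.2))
    obtain ⟨y, hy, hy'⟩ := (h2.and self_mem_nhdsWithin).exists
    exact (quantile_le_of_le (tendsto_cdf_atBot μ) (monotone_cdf μ) hτ.1 hy.le).trans_lt hy'

lemma measurable_cdf_kernel {α : Type*} [MeasurableSpace α] (κ : Kernel α ℝ) [IsMarkovKernel κ] :
    Measurable fun q : α × ℝ => cdf (κ q.1) q.2 := by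
  have h1 := Kernel.measurable_kernel_prodMk_left (κ := κ.prodMkRight ℝ)
    (measurableSet_le measurable_snd measurable_fst.snd :
      MeasurableSet {r : (α × ℝ) × ℝ | r.2 ≤ r.1.2})
  convert h1.ennreal_toReal using 2 with q
  rw [cdf_eq_real]
  rfl

lemma measurable_cdf_kernel_comp {α β : Type*} [MeasurableSpace α] [MeasurableSpace β]
    (κ : Kernel α ℝ) [IsMarkovKernel κ] {g : β → α} {u : β → ℝ} (hg : Measurable g)
    (hu : Measurable u) : Measurable fun b => cdf (κ (g b)) (u b) :=
  (measurable_cdf_kernel κ).comp (hg.prodMk hu)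

/-- A sequence of positive increments tending to zero. -/
lemma tendsto_one_div_add_one_nhdsGT :
    Tendsto (fun n : ℕ => 1 / ((n : ℝ) + 1)) atTop (𝓝[>] 0) :=
  tendsto_nhdsWithin_iff.2 ⟨tendsto_one_div_add_atTop_nhds_zero_nat,
    .of_forall fun n => by simp only [mem_Ioi]; positivity⟩

/-! ### The marginal density of `U` -/

namespace DominatedDensity

variable {E : Type*} [MeasurableSpace E] {μ : Measure E} {U R : E → ℝ} {f : ℝ → ℝ → ℝ} {G : ℝ → ℝ}

lemma map_absolutelyContinuous (H : DominatedDensity μ U R f G) : μ.map U ≪ volume := by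
  refine Measure.AbsolutelyContinuous.mk fun s hs h0 => ?_
  have h1 : μ.map U s = μ.map (fun e => (U e, R e)) (s ×ˢ univ) := by
    rw [Measure.map_apply H.measurable_left hs,
      Measure.map_apply (H.measurable_left.prodMk H.measurable_right) (hs.prod .univ)]
    congr 1; ext e; simp
  rw [h1, H.map_eq]
  refine withDensity_absolutelyContinuous _ _ ?_
  rw [Measure.volume_eq_prod, Measure.prod_prod, h0, zero_mul]

lemma nullSingletonClass_map (H : DominatedDensity μ U R f G) : NullSingletonClass (μ.map U) :=
  ⟨fun x => H.map_absolutelyContinuous (measure_singleton x)⟩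

lemma tendsto_cdf_slope [IsProbabilityMeasure μ] (H : DominatedDensity μ U R f G) {y : ℝ}
    (hy : ∀ y', ContinuousAt (fun u => f u y') y) :
    Tendsto (fun t : ℝ => t⁻¹ • (cdf (μ.map U) (y + t) - cdf (μ.map U) y)) (𝓝[>] 0)
      (𝓝 (∫ y', f y y')) := by
  have := Measure.isProbabilityMeasure_map (μ := μ) H.measurable_left.aemeasurable
  have h := H.tendsto_strip (φ := fun _ => 1) measurable_const (by simpa using H.integrable) hy
  simp only [one_mul] at h
  refine h.congr' ?_
  filter_upwards [self_mem_nhdsWithin] with t ht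
  have ht' : (0 : ℝ) < t := ht
  rw [cdf_sub_cdf _ (by linarith), map_measureReal_apply H.measurable_left measurableSet_Ioc]
  simp

/-- The strips give only the right difference quotient, hence the separate differentiability
hypothesis. -/
lemma deriv_cdf [IsProbabilityMeasure μ] (H : DominatedDensity μ U R f G) {y : ℝ}
    (hy : ∀ y', ContinuousAt (fun u => f u y') y)
    (hd : DifferentiableAt ℝ (cdf (μ.map U)) y) : deriv (cdf (μ.map U)) y = ∫ y', f y y' :=
  tendsto_nhds_unique hd.hasDerivAt.tendsto_slope_zero_right (H.tendsto_cdf_slope hy)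

/-- Cutting the density off outside the support of `U` makes it continuous at every point that is
not on the boundary of the support. -/
lemma exists_continuousAt [IsProbabilityMeasure μ] (H : DominatedDensity μ U R f G)
    (hc : ∀ y', ContinuousOn (fun y => f y y') (interior (μ.map U).support)) :
    ∃ f', DominatedDensity μ U R f' G ∧
      (∀ y ∉ frontier (μ.map U).support, ∀ y', ContinuousAt (fun u => f' u y') y) ∧
      ∀ y ∉ (μ.map U).support, ∀ y', f' y y' = 0 := by
  set S := (μ.map U).support with hS
  have hcl : IsClosed S := Measure.isClosed_support
  have hoff : ∀ y ∉ S, ∀ y', (S.indicator (fun u => f u y')) y = 0 := fun y hy y' =>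
    indicator_of_notMem hy _
  have hSm : MeasurableSet (S ×ˢ (univ : Set ℝ)) := hcl.measurableSet.prod .univ
  have hfun : (fun p : ℝ × ℝ => ENNReal.ofReal (S.indicator (fun u => f u p.2) p.1)) =
      (S ×ˢ (univ : Set ℝ)).indicator fun p => ENNReal.ofReal (f p.1 p.2) := by
    ext p
    by_cases hp : p.1 ∈ S
    · rw [indicator_of_mem hp, indicator_of_mem (show p ∈ S ×ˢ (univ : Set ℝ) from ⟨hp, trivial⟩)]
    · rw [indicator_of_notMem hp, indicator_of_notMem (fun h => hp h.1), ENNReal.ofReal_zero]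
  refine ⟨fun y y' => S.indicator (fun u => f u y') y, ?_, ?_, hoff⟩
  · refine ⟨H.measurable_left, H.measurable_right, ?_, fun y y' => ?_, ?_, fun y y' => ?_,
      H.integrable, H.integrable_mul⟩
    · have : Function.uncurry (fun y y' => S.indicator (fun u => f u y') y) =
          (S ×ˢ (univ : Set ℝ)).indicator (Function.uncurry f) := by
        ext p
        by_cases hp : p.1 ∈ S
        · rw [indicator_of_mem (show p ∈ S ×ˢ (univ : Set ℝ) from ⟨hp, trivial⟩)]
          exact indicator_of_mem hp fun u => f u p.2
        · rw [indicator_of_notMem (fun h => hp h.1)]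
          exact indicator_of_notMem hp fun u => f u p.2
      rw [this]
      exact H.measurable_density.indicator hSm
    · exact indicator_nonneg (fun u _ => H.nonneg u y') y
    · rw [hfun, withDensity_indicator hSm, ← restrict_withDensity hSm, ← H.map_eq]
      refine (Measure.restrict_eq_self_of_ae_mem ?_).symm
      refine (ae_map_iff (H.measurable_left.prodMk H.measurable_right).aemeasurable hSm).2 ?_
      filter_upwards [ae_of_ae_map H.measurable_left.aemeasurable
        (Measure.support_mem_ae (μ := μ.map U))] with e he
      exact ⟨he, trivial⟩
    · by_cases hp : y ∈ S
      · rw [indicator_of_mem hp]; exact H.le _ _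
      · rw [indicator_of_notMem hp]; exact H.dominating_nonneg _
  · intro y hy y'
    -- A point off the frontier is interior to the support, where `f` is continuous, or lies in the
    -- open complement, where the cut-off density is zero.
    by_cases hp : y ∈ S
    · have hi : y ∈ interior S := by
        by_contra h
        exact hy ⟨subset_closure hp, h⟩
      refine ((hc y').continuousAt (isOpen_interior.mem_nhds hi)).congr ?_
      filter_upwards [isOpen_interior.mem_nhds hi] with u hu
      exact (indicator_of_mem (interior_subset hu) fun u => f u y').symm
    · refine (continuousAt_const (y := (0 : ℝ))).congr ?_
      filter_upwards [hcl.isOpen_compl.mem_nhds hp] with u hu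
      exact (hoff u hu y').symm

end DominatedDensity

/-! ### Measurability and densities in the model -/

namespace TriangularModel

variable {Ω E : Type*} [MeasurableSpace Ω] [MeasurableSpace E] {k : ℕ}

lemma measurable_D (M : TriangularModel Ω E k) : Measurable M.D :=
  M.measurable_h.comp (M.measurable_Z.prodMk (M.measurable_X.prodMk M.measurable_η))

lemma measurable_Y (M : TriangularModel Ω E k) : Measurable M.Y :=
  M.measurable_m.comp (M.measurable_D.prodMk (M.measurable_X.prodMk M.measurable_ε))

lemma measurable_Ycf (M : TriangularModel Ω E k) {t : ℝ} (ht : t ∈ Icc (0 : ℝ) 1) :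
    Measurable (M.Ycf t) :=
  M.measurable_m.comp (((M.measurable_policy t ht).comp M.measurable_D).prodMk
    (M.measurable_X.prodMk M.measurable_ε))

lemma measurable_V (M : TriangularModel Ω E k) (P : Measure Ω) [IsFiniteMeasure P] :
    Measurable (M.V P) := by
  unfold V
  exact measurable_cdf_kernel_comp _ (M.measurable_Z.prodMk M.measurable_X) M.measurable_D

lemma measurable_W (M : TriangularModel Ω E k) (P : Measure Ω) [IsFiniteMeasure P] :
    Measurable (M.W P) :=
  M.measurable_D.prodMk ((M.measurable_V P).prodMk M.measurable_X)

lemma measurable_m_section (M : TriangularModel Ω E k) (d : ℝ) (x : Covariates k) :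
    Measurable (M.m d x) :=
  M.measurable_m.comp (measurable_const.prodMk (measurable_const.prodMk measurable_id))

/-- A pointwise limit of difference quotients along `1 / (n + 1)`, which gives joint measurability
in `(d, x, e)`. -/
lemma measurable_dm (M : TriangularModel Ω E k) :
    Measurable fun p : ℝ × Covariates k × E => M.dm p.1 p.2.1 p.2.2 := by
  refine measurable_of_tendsto_metrizable (f := fun (n : ℕ) (p : ℝ × Covariates k × E) =>
    (1 / ((n : ℝ) + 1))⁻¹ • (M.m (p.1 + 1 / ((n : ℝ) + 1)) p.2.1 p.2.2 - M.m p.1 p.2.1 p.2.2))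
    (fun n => ?_) (tendsto_pi_nhds.2 fun p => ?_)
  · simp only [smul_eq_mul]
    refine Measurable.const_mul (Measurable.sub ?_ M.measurable_m) _
    exact M.measurable_m.comp ((measurable_fst.add_const _).prodMk measurable_snd)
  · have h : DifferentiableAt ℝ (fun d => M.m d p.2.1 p.2.2) p.1 :=
      ((M.contDiff_m p.2.1 p.2.2).differentiable one_ne_zero).differentiableAt
    exact h.hasDerivAt.tendsto_slope_zero_right.comp tendsto_one_div_add_one_nhdsGT

lemma measurable_dm_section (M : TriangularModel Ω E k) (d : ℝ) (x : Covariates k) :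
    Measurable (M.dm d x) :=
  M.measurable_dm.comp (measurable_const.prodMk (measurable_const.prodMk measurable_id))

lemma measurable_policyDot (M : TriangularModel Ω E k) : Measurable M.policyDot := by
  refine measurable_of_tendsto_metrizable (f := fun (n : ℕ) (d : ℝ) =>
    (1 / ((n : ℝ) + 1))⁻¹ * (M.policy (1 / ((n : ℝ) + 1)) d - M.policy 0 d))
    (fun n => ?_) (tendsto_pi_nhds.2 fun d => ?_)
  · have hn : 1 / ((n : ℝ) + 1) ∈ Icc (0 : ℝ) 1 := by
      refine ⟨by positivity, ?_⟩
      rw [div_le_one (by positivity)]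
      linarith [n.cast_nonneg (α := ℝ)]
    exact ((M.measurable_policy _ hn).sub
      (M.measurable_policy 0 ⟨le_rfl, zero_le_one⟩)).const_mul _
  · have h : HasDerivWithinAt (fun t => M.policy t d) (M.policyDot d) (Icc 0 1) 0 :=
      ((M.contDiff_policy d).differentiableWithinAt one_ne_zero).hasDerivWithinAt
    rw [hasDerivWithinAt_iff_tendsto_slope] at h
    have hl : 𝓝[>] (0 : ℝ) ≤ 𝓝[Icc 0 1 \ {0}] 0 := by
      refine nhdsWithin_le_iff.2 ?_
      filter_upwards [Ioc_mem_nhdsGT zero_lt_one] with t ht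
      exact ⟨⟨ht.1.le, ht.2⟩, ht.1.ne'⟩
    have h2 := (h.mono_left hl).comp tendsto_one_div_add_one_nhdsGT
    refine h2.congr fun n => ?_
    simp [slope_def_field, div_eq_inv_mul]

lemma exists_policyDot_bound (M : TriangularModel Ω E k) :
    ∃ B : ℝ, 0 ≤ B ∧ ∀ d, |M.policyDot d| ≤ B := by
  obtain ⟨B, hB⟩ := M.bounded_policy
  exact ⟨B, (abs_nonneg _).trans (hB 0), hB⟩

lemma ae_inSupports (M : TriangularModel Ω E k) (P : Measure Ω) [IsFiniteMeasure P] :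
    ∀ᵐ w ∂(P.map (M.W P)), M.InSupports P w.1 w.2.1 w.2.2 := by
  have hm : MeasurableSet {w : ℝ × ℝ × Covariates k | M.InSupports P w.1 w.2.1 w.2.2} :=
    (Measure.isClosed_support.measurableSet.preimage measurable_fst).inter
      ((Measure.isClosed_support.measurableSet.preimage measurable_snd.fst).inter
        (Measure.isClosed_support.measurableSet.preimage measurable_snd.snd))
  refine (ae_map_iff (M.measurable_W P).aemeasurable hm).2 ?_
  filter_upwards [ae_of_ae_map M.measurable_D.aemeasurable
      (Measure.support_mem_ae (μ := P.map M.D)),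
    ae_of_ae_map (M.measurable_V P).aemeasurable (Measure.support_mem_ae (μ := P.map (M.V P))),
    ae_of_ae_map M.measurable_X.aemeasurable (Measure.support_mem_ae (μ := P.map M.X))]
    with ω h1 h2 h3
  exact ⟨h1, h2, h3⟩

lemma exists_dominatedDensity_outcome (M : TriangularModel Ω E k) (P : Measure Ω)
    [IsProbabilityMeasure P] (hR1 : M.OutcomeRegular P) :
    ∃ f G, DominatedDensity P M.Y (fun ω => M.mDot (M.D ω) (M.X ω) (M.ε ω)) f G ∧
      ∀ y ∈ interior (M.suppY P), ∀ y', ContinuousAt (fun u => f u y') y := by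
  obtain ⟨f, hfm, hf0, hmap, hcont, g, C, hg, hg', hC, hle⟩ := hR1.joint_density
  refine ⟨f, fun y' => C * |g y'|,
    ⟨M.measurable_Y, ?_, hfm, hf0, hmap, hle, hg.abs.const_mul C, ?_⟩,
    fun y hy y' => (hcont y').continuousAt (isOpen_interior.mem_nhds hy)⟩
  · exact (M.measurable_policyDot.comp M.measurable_D).mul
      (M.measurable_dm.comp (M.measurable_D.prodMk (M.measurable_X.prodMk M.measurable_ε)))
  · refine (hg'.norm.const_mul C).mono ?_ (.of_forall fun y' => ?_)
    · exact aestronglyMeasurable_id.mul (hg.abs.const_mul C).1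
    · simp only [norm_mul, Real.norm_eq_abs, abs_abs]
      exact le_of_eq (by ring)

lemma exists_dominatedDensity_cond (M : TriangularModel Ω E k) (P : Measure Ω)
    [IsProbabilityMeasure P] (K : Kernel (ℝ × ℝ × Covariates k) E) [IsMarkovKernel K]
    (hR3 : M.ConditionalRegular P K) :
    ∃ G, ∀ d v x, M.InSupports P d v x →
      ∃ f, DominatedDensity (K (d, v, x)) (M.m d x) (M.dm d x) f G ∧
      (∀ y ∉ frontier (M.condSuppY K d v x), ∀ y', ContinuousAt (fun u => f u y') y) ∧
      ∀ y ∉ M.condSuppY K d v x, ∀ y', f y y' = 0 := by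
  obtain ⟨g, C, hg, hg', hC, H⟩ := hR3.joint_density
  refine ⟨fun y' => C * |g y'|, fun d v x hw => ?_⟩
  obtain ⟨f, hfm, hf0, hmap, hcont, hle⟩ := H d v x hw
  have hD : DominatedDensity (K (d, v, x)) (M.m d x) (M.dm d x) f (fun y' => C * |g y'|) := by
    refine ⟨M.measurable_m_section d x, M.measurable_dm_section d x, hfm, hf0, hmap, hle,
      hg.abs.const_mul C, ?_⟩
    refine (hg'.norm.const_mul C).mono ?_ (.of_forall fun y' => ?_)
    · exact aestronglyMeasurable_id.mul (hg.abs.const_mul C).1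
    · simp only [norm_mul, Real.norm_eq_abs, abs_abs]
      exact le_of_eq (by ring)
  exact hD.exists_continuousAt hcont

/-- Off the closed support the distribution function is locally constant. -/
lemma condDensityY_eq_zero (M : TriangularModel Ω E k) {K : Kernel (ℝ × ℝ × Covariates k) E}
    [IsMarkovKernel K] {y d v : ℝ} {x : Covariates k}
    (hy : y ∉ M.condSuppY K d v x) : M.condDensityY K y d v x = 0 := by
  have : IsProbabilityMeasure (M.condLawY K d v x) :=
    Measure.isProbabilityMeasure_map (M.measurable_m_section d x).aemeasurable
  obtain ⟨s, hs, h0⟩ := Measure.notMem_support_iff_exists.1 hy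
  obtain ⟨r, hr, hrs⟩ := Metric.mem_nhds_iff.1 hs
  have hconst : (fun u => M.condCdfY K u d v x) =ᶠ[𝓝 y] fun _ => M.condCdfY K y d v x := by
    filter_upwards [Metric.ball_mem_nhds y hr] with u hu
    have hnull : ∀ a b : ℝ, a ∈ Metric.ball y r → b ∈ Metric.ball y r → a ≤ b →
        M.condCdfY K a d v x = M.condCdfY K b d v x := by
      intro a b ha hb hab
      have h1 := cdf_sub_cdf (M.condLawY K d v x) hab
      have h2 : (M.condLawY K d v x) (Ioc a b) = 0 := by
        refine measure_mono_null (Ioc_subset_Icc_self.trans (Subset.trans ?_ hrs)) h0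
        rw [Real.ball_eq_Ioo] at ha hb ⊢
        exact fun z hz => ⟨ha.1.trans_le hz.1, hz.2.trans_lt hb.2⟩
      rw [measureReal_def, h2, ENNReal.toReal_zero] at h1
      simp only [condCdfY]
      linarith
    rcases le_total u y with h | h
    · exact hnull _ _ hu (Metric.mem_ball_self hr) h
    · exact (hnull _ _ (Metric.mem_ball_self hr) hu h).symm
  rw [condDensityY, hconst.deriv_eq, deriv_const]

/-- In the interior of the support, differentiability comes for free: `deriv` is zero by default
where there is no derivative, and the density is assumed positive. -/
lemma condDensityY_eq_integral (M : TriangularModel Ω E k) {P : Measure Ω}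
    [IsProbabilityMeasure P] {K : Kernel (ℝ × ℝ × Covariates k) E} [IsMarkovKernel K]
    (hR3 : M.ConditionalRegular P K) {y d v : ℝ} {x : Covariates k} (hw : M.InSupports P d v x)
    {f : ℝ → ℝ → ℝ} {G : ℝ → ℝ} (H : DominatedDensity (K (d, v, x)) (M.m d x) (M.dm d x) f G)
    (hc : ∀ y ∉ frontier (M.condSuppY K d v x), ∀ y', ContinuousAt (fun u => f u y') y)
    (h0 : ∀ y ∉ M.condSuppY K d v x, ∀ y', f y y' = 0)
    (hy : y ∉ frontier (M.condSuppY K d v x)) :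
    M.condDensityY K y d v x = ∫ y', f y y' := by
  by_cases hp : y ∈ M.condSuppY K d v x
  · have hi : y ∈ interior (M.condSuppY K d v x) := by
      by_contra h
      exact hy ⟨subset_closure hp, h⟩
    have hpos := hR3.density_pos d v x hw y hi
    exact H.deriv_cdf (hc y hy) (differentiableAt_of_deriv_ne_zero hpos.ne')
  · rw [M.condDensityY_eq_zero hp]
    simp [h0 y hp]

end TriangularModel

/-! ### Null sets of flat points, and inversion of the rank transform -/

/-- The exceptional `p` fill a stretch to the right of `c` on which the distribution function is
flat. Either it has a greatest element and lies in one null interval, or rational points of the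
stretch cover it by countably many. -/
lemma ae_cdf_lt_cdf (μ : Measure ℝ) [IsProbabilityMeasure μ] (c : ℝ) :
    ∀ᵐ p ∂μ, c < p → cdf μ c < cdf μ p := by
  set N := {p | c < p ∧ cdf μ p ≤ cdf μ c} with hN
  have hIoc : ∀ p ∈ N, μ (Ioc c p) = 0 := fun p hp => by
    have h1 := cdf_sub_cdf μ hp.1.le
    have h2 : μ.real (Ioc c p) = 0 := le_antisymm (by linarith [hp.2]) measureReal_nonneg
    exact (measureReal_eq_zero_iff (measure_ne_top _ _)).1 h2
  have hnull : μ N = 0 := by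
    by_cases hmax : ∃ m, IsGreatest N m
    · obtain ⟨m, hm, hmax⟩ := hmax
      exact measure_mono_null (t := Ioc c m) (fun p hp => ⟨hp.1, hmax hp⟩) (hIoc m hm)
    · have hsub : N ⊆ ⋃ q : {q : ℚ // (q : ℝ) ∈ N}, Ioc c (q : ℝ) := by
        intro p hp
        have : ∃ p' ∈ N, p < p' := by
          by_contra! h
          exact hmax ⟨p, hp, h⟩
        obtain ⟨p', hp', hlt⟩ := this
        obtain ⟨q, hq1, hq2⟩ := exists_rat_btwn hlt
        exact mem_iUnion.2 ⟨⟨q, hp.1.trans hq1, (monotone_cdf μ hq2.le).trans hp'.2⟩, hp.1, hq1.le⟩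
      exact measure_mono_null hsub (measure_iUnion_null fun q => hIoc _ q.2)
  refine measure_mono_null (fun p hp => ?_) hnull
  simp only [mem_compl_iff, mem_ofPred_eq, Classical.not_imp, not_lt] at hp
  exact hp

/-- The same covering argument from the left; a least exceptional point is not in its own open
interval, so it must not be an atom. -/
lemma ae_measure_Ioo_pos (μ : Measure ℝ) [NullSingletonClass μ] (c : ℝ) :
    ∀ᵐ p ∂μ, p < c → 0 < μ (Ioo p c) := by
  set N := {p | p < c ∧ μ (Ioo p c) = 0} with hN
  have hnull : μ N = 0 := by
    by_cases hmin : ∃ m, IsLeast N m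
    · obtain ⟨m, hm, hmin⟩ := hmin
      refine measure_mono_null (t := {m} ∪ Ioo m c) (fun p hp => ?_)
        (measure_union_null (measure_singleton m) hm.2)
      rcases (hmin hp).eq_or_lt with h | h
      · exact Or.inl h.symm
      · exact Or.inr ⟨h, hp.1⟩
    · have hsub : N ⊆ ⋃ q : {q : ℚ // (q : ℝ) ∈ N}, Ioo (q : ℝ) c := by
        intro p hp
        have : ∃ p' ∈ N, p' < p := by
          by_contra! h
          exact hmin ⟨p, hp, h⟩
        obtain ⟨p', hp', hlt⟩ := this
        obtain ⟨q, hq1, hq2⟩ := exists_rat_btwn hlt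
        exact mem_iUnion.2 ⟨⟨q, hq2.trans hp.1,
          measure_mono_null (Ioo_subset_Ioo_left hq1.le) hp'.2⟩, hq2, hp.1⟩
      exact measure_mono_null hsub (measure_iUnion_null fun q => q.2.2)
  refine measure_mono_null (fun p hp => ?_) hnull
  simp only [mem_compl_iff, mem_ofPred_eq, Classical.not_imp, not_lt, nonpos_iff_eq_zero] at hp
  exact hp

/-- The probability integral transform of each member of a kernel has a measurable inverse. -/
lemma exists_measurable_cdf_inverse {α : Type*} [MeasurableSpace α] (ν : Kernel α ℝ)
    [IsMarkovKernel ν] : ∃ r : ℝ × α → ℝ, Measurable r ∧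
      ∀ a, ∀ᵐ p ∂(ν a), r (cdf (ν a) p, a) = p := by
  -- The generalized inverse, taken over rationals so that it is a countable infimum and measurable;
  -- in `EReal` the value `⊤` stands for rationals that do not qualify.
  refine ⟨fun q => (⨅ c : ℚ, if q.1 ≤ cdf (ν q.2) c then (((c : ℝ)) : EReal) else ⊤).toReal,
    ?_, fun a => ?_⟩
  · refine measurable_ereal_toReal.comp (Measurable.iInf fun c => ?_)
    exact Measurable.ite (measurableSet_le measurable_fst
      (measurable_cdf_kernel_comp ν measurable_snd measurable_const)) measurable_const
      measurable_const
  · have h : ∀ᵐ p ∂(ν a), ∀ c : ℚ, (c : ℝ) < p → cdf (ν a) c < cdf (ν a) p :=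
      ae_all_iff.2 fun c => ae_cdf_lt_cdf (ν a) c
    filter_upwards [h] with p hp
    have hinf : (⨅ c : ℚ, if cdf (ν a) p ≤ cdf (ν a) c then (((c : ℝ)) : EReal) else ⊤) =
        (p : EReal) := by
      refine le_antisymm ?_ (le_iInf fun c => ?_)
      · refine le_of_forall_gt fun z hz => ?_
        obtain ⟨c, hc1, hc2⟩ := EReal.exists_rat_btwn_of_lt hz
        refine (iInf_le _ c).trans_lt ?_
        have hc1' : p < (c : ℝ) := by exact_mod_cast hc1
        rw [if_pos (monotone_cdf _ hc1'.le)]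
        exact hc2
      · split_ifs with hc
        · rw [EReal.coe_le_coe_iff]
          by_contra hlt
          exact absurd (hp c (not_le.1 hlt)) (not_lt.2 hc)
        · exact le_top
    simp only [hinf, EReal.toReal_coe]

/-! ### Conditional distributions in general -/

lemma ProbabilityTheory.HasCondDistrib.of_condDistrib_ae_eq {Ω α β : Type*}
    [MeasurableSpace Ω] [MeasurableSpace α]
    [MeasurableSpace β] [StandardBorelSpace β] [Nonempty β] {P : Measure Ω} [IsFiniteMeasure P]
    {Y : Ω → β} {X : Ω → α} {κ : Kernel α β} [IsFiniteKernel κ] (hX : Measurable X)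
    (hY : Measurable Y) (h : condDistrib Y X P =ᵐ[P.map X] κ) : HasCondDistrib Y X κ P :=
  ⟨(hX.prodMk hY).aemeasurable,
    (condDistrib_ae_eq_iff_measure_eq_compProd X hY.aemeasurable κ).1 h⟩

lemma ProbabilityTheory.HasCondDistrib.condDistrib_ae_eq {Ω α β : Type*}
    [MeasurableSpace Ω] [MeasurableSpace α]
    [MeasurableSpace β] [StandardBorelSpace β] [Nonempty β] {P : Measure Ω} [IsFiniteMeasure P]
    {Y : Ω → β} {X : Ω → α} {κ : Kernel α β} [IsFiniteKernel κ]
    (h : HasCondDistrib Y X κ P) : condDistrib Y X P =ᵐ[P.map X] κ :=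
  condDistrib_ae_eq_of_measure_eq_compProd X h.aemeasurable_snd h.map_eq

lemma ProbabilityTheory.HasCondDistrib.congr_right {Ω α β : Type*}
    [MeasurableSpace Ω] [MeasurableSpace α]
    [MeasurableSpace β] {P : Measure Ω} {Y : Ω → β} {X X' : Ω → α} {κ : Kernel α β}
    (h : HasCondDistrib Y X κ P) (hX : X =ᵐ[P] X') : HasCondDistrib Y X' κ P := by
  have hp : (fun ω => (X' ω, Y ω)) =ᵐ[P] fun ω => (X ω, Y ω) := by
    filter_upwards [hX] with ω hω
    rw [hω]
  exact ⟨h.aemeasurable.congr hp.symm,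
    by rw [Measure.map_congr hp, h.map_eq, Measure.map_congr hX]⟩

/-- The conditional law of a function of `A` and `B` given `A`. -/
lemma ProbabilityTheory.HasCondDistrib.condDistrib_comp_prodMk {Ω α β γ : Type*} [MeasurableSpace Ω]
    [MeasurableSpace α] [MeasurableSpace β] [MeasurableSpace γ] [StandardBorelSpace γ] [Nonempty γ]
    {P : Measure Ω} [IsFiniteMeasure P] {A : Ω → α} {B : Ω → β} {κ : Kernel α β} [IsMarkovKernel κ]
    (hA : Measurable A) (hB : Measurable B) (h : HasCondDistrib B A κ P) {F : α × β → γ}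
    (hF : Measurable F) :
    ∀ᵐ a ∂(P.map A), condDistrib (fun ω => F (A ω, B ω)) A P a = (κ a).map fun b => F (a, b) := by
  have hT : Measurable fun p : α × β => (p.1, F p) := measurable_fst.prodMk hF
  have hk : ∀ a, ((Kernel.id ×ₖ κ).map F) a = (κ a).map fun b => F (a, b) := fun a => by
    rw [Kernel.map_apply _ hF, Kernel.prod_apply, Kernel.id_apply, Measure.dirac_prod,
      Measure.map_map hF measurable_prodMk_left]
    rfl
  have : IsMarkovKernel ((Kernel.id ×ₖ κ).map F) := Kernel.IsMarkovKernel.map _ hF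
  have h1 : P.map (fun ω => (A ω, F (A ω, B ω))) = P.map A ⊗ₘ ((Kernel.id ×ₖ κ).map F) := by
    ext s hs
    rw [Measure.compProd_apply hs]
    have h2 : P.map (fun ω => (A ω, F (A ω, B ω)))
        = (P.map fun ω => (A ω, B ω)).map fun p : α × β => (p.1, F p) := by
      rw [Measure.map_map hT (hA.prodMk hB)]
      rfl
    rw [h2, h.map_eq, Measure.map_apply hT hs, Measure.compProd_apply (hT hs)]
    refine lintegral_congr fun a => ?_
    have hFa : Measurable fun b => F (a, b) := hF.comp measurable_prodMk_left
    rw [hk, Measure.map_apply hFa (measurable_prodMk_left hs)]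
    rfl
  filter_upwards [condDistrib_ae_eq_of_measure_eq_compProd A
    (hF.comp (hA.prodMk hB)).aemeasurable h1] with a ha
  exact Eq.trans ha (hk a)

/-! ### The control variable -/

namespace TriangularModel

variable {Ω E : Type*} [MeasurableSpace Ω] [StandardBorelSpace Ω] [MeasurableSpace E] {k : ℕ}

/-- Given `(Z, X)`, `D` is the image of `η` under `h(Z, X, ·)`, and the law of `η` given `(Z, X)` is
its law given `X` by conditional independence. -/
lemma ae_condDistrib_D (M : TriangularModel Ω E k) (P : Measure Ω) [IsProbabilityMeasure P]
    (hC : M.ControlConditions P) :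
    ∀ᵐ ω ∂P, condDistrib M.D (fun ω' => (M.Z ω', M.X ω')) P (M.Z ω, M.X ω) =
      (condDistrib M.η M.X P (M.X ω)).map (M.h (M.Z ω) (M.X ω)) := by
  have hZX : Measurable fun ω => (M.Z ω, M.X ω) := M.measurable_Z.prodMk M.measurable_X
  have hind : M.Z ⟂ᵢ[M.X, M.measurable_X; P] M.η :=
    (CondIndepFun.comp hC.condIndep measurable_snd measurable_id).symm
  have h1 := (condIndepFun_iff_condDistrib_prod_ae_eq_prodMkRight M.measurable_η M.measurable_Z
    M.measurable_X).1 hind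
  have h2 : HasCondDistrib M.η (fun ω => (M.X ω, M.Z ω))
      ((condDistrib M.η M.X P).prodMkRight ℝ) P :=
    HasCondDistrib.of_condDistrib_ae_eq (M.measurable_X.prodMk M.measurable_Z) M.measurable_η h1
  have h3 : HasCondDistrib M.η (fun ω => (M.Z ω, M.X ω))
      ((condDistrib M.η M.X P).comap (Prod.snd : ℝ × Covariates k → _) measurable_snd) P :=
    h2.measurableEquiv_comp_right MeasurableEquiv.prodComm
  have hF : Measurable fun p : (ℝ × Covariates k) × ℝ => M.h p.1.1 p.1.2 p.2 :=
    M.measurable_h.comp (measurable_fst.fst.prodMk (measurable_fst.snd.prodMk measurable_snd))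
  exact ae_of_ae_map hZX.aemeasurable
    (HasCondDistrib.condDistrib_comp_prodMk hZX M.measurable_η h3 hF)

/-- The control variable is the conditional rank of the selection disturbance, up to reflection. -/
lemma exists_V_eq (M : TriangularModel Ω E k) (P : Measure Ω) [IsProbabilityMeasure P]
    (hC : M.ControlConditions P) :
    ∃ ψ : ℝ → ℝ, Measurable ψ ∧ (∀ u, ψ (ψ u) = u) ∧
      ∀ᵐ ω ∂P, M.V P ω = ψ (cdf (condDistrib M.η M.X P (M.X ω)) (M.η ω)) := by
  have hηS : ∀ᵐ ω ∂P, M.η ω ∈ (P.map M.η).support :=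
    ae_of_ae_map M.measurable_η.aemeasurable (Measure.support_mem_ae (μ := P.map M.η))
  -- Monotonicity is known only on the support of the marginal law of `η`; almost every conditional
  -- law is carried by it.
  have hνS : ∀ᵐ ω ∂P, ∀ᵐ p ∂(condDistrib M.η M.X P (M.X ω)), p ∈ (P.map M.η).support := by
    have hS : MeasurableSet {q : Covariates k × ℝ | q.2 ∈ (P.map M.η).support} :=
      Measure.isClosed_support.measurableSet.preimage measurable_snd
    have h1 : ∀ᵐ q ∂(P.map M.X ⊗ₘ condDistrib M.η M.X P), q.2 ∈ (P.map M.η).support := by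
      rw [compProd_map_condDistrib M.measurable_η.aemeasurable]
      exact (ae_map_iff (M.measurable_X.prodMk M.measurable_η).aemeasurable hS).2 hηS
    exact ae_of_ae_map M.measurable_X.aemeasurable (Measure.ae_ae_of_ae_compProd h1)
  have hV : ∀ᵐ ω ∂P, M.V P ω =
      (condDistrib M.η M.X P (M.X ω)).real
        {p | M.h (M.Z ω) (M.X ω) p ≤ M.h (M.Z ω) (M.X ω) (M.η ω)} := by
    filter_upwards [M.ae_condDistrib_D P hC] with ω hω
    rw [V, hω, cdf_map_apply]
    · rfl
    · exact M.measurable_h.comp (measurable_const.prodMk (measurable_const.prodMk measurable_id))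
  rcases hC.monotonic with hm | hm
  · refine ⟨id, measurable_id, fun _ => rfl, ?_⟩
    filter_upwards [hηS, hνS, hV, hm] with ω h1 h2 h3 h4
    rw [h3, id, cdf_eq_real]
    refine measureReal_congr ?_
    filter_upwards [h2] with p hp
    exact propext (h4.le_iff_le hp h1)
  · refine ⟨fun u => 1 - u, measurable_const.sub measurable_id, fun _ => sub_sub_cancel _ _, ?_⟩
    filter_upwards [hηS, hνS, hV, hm, ae_of_ae_map M.measurable_X.aemeasurable hC.cdf_η]
      with ω h1 h2 h3 h4 h5
    set ν := condDistrib M.η M.X P (M.X ω) with hν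
    have hsing : ν {M.η ω} = 0 := by
      rw [← measure_cdf ν, (cdf ν).measure_singleton,
        h5.1.continuousAt.continuousWithinAt.leftLim_eq, sub_self, ENNReal.ofReal_zero]
    rw [h3, cdf_eq_real, ← probReal_compl_eq_one_sub measurableSet_Iic]
    refine measureReal_congr ?_
    filter_upwards [h2, measure_eq_zero_iff_ae_notMem.1 hsing] with p hp hne
    refine propext ((h4.le_iff_ge hp h1).trans ?_)
    simp only [mem_singleton_iff] at hne
    change M.η ω ≤ p ↔ ¬ p ≤ M.η ω
    exact ⟨fun h => not_le.2 (lt_of_le_of_ne h (Ne.symm hne)), fun h => (not_le.1 h).le⟩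

/-- Given the control variable and the covariates, the outcome disturbance does not depend on the
policy variable. -/
lemma ae_kernel_eq [StandardBorelSpace E] [Nonempty E] (M : TriangularModel Ω E k) (P : Measure Ω)
    [IsProbabilityMeasure P]
    (hC : M.ControlConditions P) (K : Kernel (ℝ × ℝ × Covariates k) E) [IsMarkovKernel K]
    (hK : HasCondDistrib M.ε (M.W P) K P) :
    ∀ᵐ w ∂(P.map (M.W P)), K w = condDistrib M.ε (fun ω => (M.V P ω, M.X ω)) P w.2 := by
  obtain ⟨ψ, hψ, hψψ, hV⟩ := M.exists_V_eq P hC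
  obtain ⟨r, hr, hrν⟩ := exists_measurable_cdf_inverse (condDistrib M.η M.X P)
  set T : Ω → ℝ × Covariates k := fun ω => (M.V P ω, M.X ω) with hT
  have hTm : Measurable T := (M.measurable_V P).prodMk M.measurable_X
  set ζ := condDistrib M.Z M.X P with hζ
  have hZ : HasCondDistrib M.Z (fun ω => (M.X ω, (M.ε ω, M.η ω))) (ζ.prodMkRight (E × ℝ)) P :=
    HasCondDistrib.of_condDistrib_ae_eq
      (M.measurable_X.prodMk (M.measurable_ε.prodMk M.measurable_η)) M.measurable_Z
      ((condIndepFun_iff_condDistrib_prod_ae_eq_prodMkRight M.measurable_Z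
        (M.measurable_ε.prodMk M.measurable_η) M.measurable_X).1 hC.condIndep)
  let ζT : Kernel (ℝ × Covariates k) ℝ := ζ.comap Prod.snd measurable_snd
  have hg : Measurable fun q : Covariates k × E × ℝ =>
      ψ (cdf (condDistrib M.η M.X P q.1) q.2.2) :=
    hψ.comp (measurable_cdf_kernel_comp _ measurable_fst measurable_snd.snd)
  have hf1 : Measurable fun q : Covariates k × E × ℝ =>
      (ψ (cdf (condDistrib M.η M.X P q.1) q.2.2), q.1) := hg.prodMk measurable_fst
  -- Given `(X, ε, η)`, the law of `Z` depends on `X` alone, so it is also the law of `Z` given any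
  -- function of `(X, ε, η)` that retains `X`, such as `(V, X)` or `(V, X, ε)`. Comparing these two
  -- gives independence of `ε` and `Z` given `(V, X)`.
  have hZT : HasCondDistrib M.Z T ζT P := by
    refine (HasCondDistrib.comp_right (hf := hf1) (κ := ζT) hZ).congr_right ?_
    filter_upwards [hV] with ω hω
    simp only [Function.comp_apply, hT, hω]
  have hZTε : HasCondDistrib M.Z (fun ω => (T ω, M.ε ω)) (ζT.prodMkRight E) P := by
    refine (HasCondDistrib.comp_right (hf := hf1.prodMk measurable_snd.fst)
      (κ := ζT.prodMkRight E) hZ).congr_right ?_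
    filter_upwards [hV] with ω hω
    simp only [Function.comp_apply, hT, hω]
  have hind : M.ε ⟂ᵢ[T, hTm; P] M.Z := by
    refine (condIndepFun_iff_condDistrib_prod_ae_eq_prodMkRight M.measurable_Z M.measurable_ε
      hTm).2 ?_
    have h1 := hZTε.condDistrib_ae_eq
    have h2 : ∀ᵐ q ∂(P.map fun ω => (T ω, M.ε ω)), condDistrib M.Z T P q.1 = ζT q.1 := by
      have : P.map T = (P.map fun ω => (T ω, M.ε ω)).map Prod.fst := by
        rw [Measure.map_map measurable_fst (hTm.prodMk M.measurable_ε)]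
        rfl
      have h3 := hZT.condDistrib_ae_eq
      rw [this] at h3
      exact ae_of_ae_map measurable_fst.aemeasurable h3
    filter_upwards [h1, h2] with q h1 h2
    rw [h1, Kernel.prodMkRight_apply, Kernel.prodMkRight_apply, h2]
  set κ₀ := condDistrib M.ε T P with hκ₀
  have hε : HasCondDistrib M.ε (fun ω => (T ω, M.Z ω)) (κ₀.prodMkRight ℝ) P :=
    HasCondDistrib.of_condDistrib_ae_eq (hTm.prodMk M.measurable_Z) M.measurable_ε
      ((condIndepFun_iff_condDistrib_prod_ae_eq_prodMkRight M.measurable_ε M.measurable_Z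
        hTm).1 hind.symm)
  have hη : ∀ᵐ ω ∂P, r (cdf (condDistrib M.η M.X P (M.X ω)) (M.η ω), M.X ω) = M.η ω := by
    have hm : MeasurableSet {q : Covariates k × ℝ |
        r (cdf (condDistrib M.η M.X P q.1) q.2, q.1) = q.2} :=
      measurableSet_eq_fun (hr.comp ((measurable_cdf_kernel _).prodMk measurable_fst))
        measurable_snd
    have h1 := Measure.ae_compProd_of_ae_ae (μ := P.map M.X) hm (.of_forall hrν)
    rw [compProd_map_condDistrib M.measurable_η.aemeasurable] at h1
    exact ae_of_ae_map (M.measurable_X.prodMk M.measurable_η).aemeasurable h1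
  -- Almost surely `η = r (ψ V, X)`, so this map sends `((V, X), Z)` to `(D, V, X)`: conditioning on
  -- `D` as well adds nothing beyond `Z`.
  have hΦ : Measurable fun q : (ℝ × Covariates k) × ℝ =>
      (M.h q.2 q.1.2 (r (ψ q.1.1, q.1.2)), q.1) :=
    (M.measurable_h.comp (measurable_snd.prodMk (measurable_fst.snd.prodMk
      (hr.comp ((hψ.comp measurable_fst.fst).prodMk measurable_fst.snd))))).prodMk measurable_fst
  have hW : HasCondDistrib M.ε (M.W P) (κ₀.prodMkLeft ℝ) P := by
    refine (HasCondDistrib.comp_right (hf := hΦ)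
      (κ := κ₀.prodMkLeft ℝ) hε).congr_right ?_
    filter_upwards [hV, hη] with ω h1 h2
    simp only [Function.comp_apply, hT, W, D]
    rw [h1, hψψ, h2]
  filter_upwards [hK.condDistrib_ae_eq, hW.condDistrib_ae_eq] with w h1 h2
  rw [← h1, h2]
  rfl

end TriangularModel

/-! ### Derivatives along good points, and measurability of supports -/

/-- Along a set that accumulates from the right, the derivative within a larger set is the limit of
difference quotients. -/
lemma derivWithin_eq_of_frequently {F Φ : ℝ → ℝ} {s A : Set ℝ} {d L : ℝ}
    (hd : DifferentiableWithinAt ℝ F s d) (hA : ∃ᶠ d' in 𝓝[>] d, d' ∈ A) (hAs : A ⊆ s)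
    (hΦ : ∀ t, d + t ∈ A → F (d + t) - F d = Φ t)
    (hlim : Tendsto (fun t => t⁻¹ * Φ t) (𝓝[>] 0) (𝓝 L)) : derivWithin F s d = L := by
  -- Both limits are compared along this filter, nontrivial because `A` accumulates at `d` from the
  -- right.
  have hne : NeBot (𝓝[>] d ⊓ 𝓟 A) := frequently_mem_iff_neBot.1 hA
  have h1 := hasDerivWithinAt_iff_tendsto_slope.1 hd.hasDerivWithinAt
  have hl : 𝓝[>] d ⊓ 𝓟 A ≤ 𝓝[s \ {d}] d := by
    refine le_inf (inf_le_left.trans nhdsWithin_le_nhds) (le_principal_iff.2 ?_)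
    filter_upwards [mem_inf_of_left self_mem_nhdsWithin, mem_inf_of_right (mem_principal_self A)]
      with z hz hzA
    exact ⟨hAs hzA, ne_of_gt hz⟩
  have hshift : Tendsto (fun z => z - d) (𝓝[>] d) (𝓝[>] 0) := by
    refine tendsto_nhdsWithin_iff.2 ⟨?_, ?_⟩
    · have : Tendsto (fun z => z - d) (𝓝 d) (𝓝 (d - d)) := tendsto_id.sub_const d
      rw [sub_self] at this
      exact this.mono_left nhdsWithin_le_nhds
    · filter_upwards [self_mem_nhdsWithin] with z hz
      exact sub_pos.2 (show d < z from hz)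
  have h2 := (hlim.comp hshift).mono_left (inf_le_left : 𝓝[>] d ⊓ 𝓟 A ≤ 𝓝[>] d)
  refine tendsto_nhds_unique (h1.mono_left hl) (h2.congr' ?_)
  filter_upwards [mem_inf_of_right (mem_principal_self A)] with z hzA
  have h3 := hΦ (z - d) (by rwa [add_sub_cancel])
  rw [add_sub_cancel] at h3
  rw [Function.comp_apply, ← h3, slope_def_field, div_eq_inv_mul]

lemma DominatedDensity.continuousAt_integral {E : Type*} [MeasurableSpace E] {μ : Measure E}
    {U R : E → ℝ} {f : ℝ → ℝ → ℝ} {G : ℝ → ℝ} (H : DominatedDensity μ U R f G) {y : ℝ}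
    (hy : ∀ y', ContinuousAt (fun u => f u y') y) : ContinuousAt (fun u => ∫ y', f u y') y := by
  refine tendsto_integral_filter_of_dominated_convergence G
    (.of_forall fun u => (H.measurable_section_right u).aestronglyMeasurable)
    (.of_forall fun u => .of_forall fun y' => ?_) H.integrable (.of_forall fun y' => hy y')
  rw [Real.norm_of_nonneg (H.nonneg _ _)]
  exact H.le _ _

lemma measurableSet_mem_support {α : Type*} [MeasurableSpace α] (L : Kernel α ℝ)
    (y : ℝ) : MeasurableSet {a | y ∈ (L a).support} := by
  have h : {a | y ∈ (L a).support} =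
      ⋂ n : ℕ, {a | 0 < L a (Metric.ball y (1 / ((n : ℝ) + 1)))} := by
    ext a
    simp only [mem_ofPred_eq, mem_iInter]
    exact (Metric.nhds_basis_ball_inv_nat_succ.mem_measureSupport).trans (by simp)
  rw [h]
  exact MeasurableSet.iInter fun n =>
    measurableSet_lt measurable_const (Kernel.measurable_coe L Metric.isOpen_ball.measurableSet)

/-- As the support is closed, a ball is contained in it once its rational points are, so interior
membership is a countable condition. -/
lemma measurableSet_mem_frontier_support {α : Type*} [MeasurableSpace α] (L : Kernel α ℝ)
    (y : ℝ) : MeasurableSet {a | y ∈ frontier (L a).support} := by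
  have hint : {a | y ∈ interior (L a).support} =
      ⋃ n : ℕ, ⋂ q : {q : ℚ // (q : ℝ) ∈ Metric.ball y (1 / ((n : ℝ) + 1))},
        {a | (q : ℝ) ∈ (L a).support} := by
    ext a
    simp only [mem_ofPred_eq, mem_iUnion, mem_iInter]
    rw [mem_interior_iff_mem_nhds, Metric.nhds_basis_ball_inv_nat_succ.mem_iff]
    constructor
    · rintro ⟨n, -, hn⟩
      exact ⟨n, fun q => hn q.2⟩
    · rintro ⟨n, hn⟩
      refine ⟨n, trivial, fun z hz => ?_⟩
      by_contra hzS
      obtain ⟨q, hq⟩ := Rat.denseRange_cast.exists_mem_open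
        (Metric.isOpen_ball.inter (Measure.isClosed_support (μ := L a)).isOpen_compl) ⟨z, hz, hzS⟩
      exact hq.2 (hn ⟨q, hq.1⟩)
  have hS : {a | y ∈ frontier (L a).support} =
      {a | y ∈ (L a).support} \ {a | y ∈ interior (L a).support} := by
    ext a
    simp only [mem_ofPred_eq, (Measure.isClosed_support (μ := L a)).frontier_eq]
    rfl
  rw [hS]
  refine (measurableSet_mem_support L y).diff ?_
  rw [hint]
  exact MeasurableSet.iUnion fun n => MeasurableSet.iInter fun q => measurableSet_mem_support L q

/-! ### Conditional distribution and quantile derivatives at almost every `(d, v, x)` -/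

namespace TriangularModel

variable {Ω E : Type*} [MeasurableSpace Ω] [MeasurableSpace E] {k : ℕ}

lemma exists_kernel_condLawY (M : TriangularModel Ω E k) (K : Kernel (ℝ × ℝ × Covariates k) E)
    [IsMarkovKernel K] : ∃ L : Kernel (ℝ × ℝ × Covariates k) ℝ,
      ∀ w, L w = M.condLawY K w.1 w.2.1 w.2.2 := by
  have hF : Measurable fun p : (ℝ × ℝ × Covariates k) × E => M.m p.1.1 p.1.2.2 p.2 :=
    M.measurable_m.comp (measurable_fst.fst.prodMk (measurable_fst.snd.snd.prodMk measurable_snd))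
  refine ⟨(Kernel.id ×ₖ K).map fun p : (ℝ × ℝ × Covariates k) × E => M.m p.1.1 p.1.2.2 p.2,
    fun w => ?_⟩
  rw [Kernel.map_apply _ hF, Kernel.prod_apply, Kernel.id_apply, Measure.dirac_prod,
    Measure.map_map hF measurable_prodMk_left]
  rfl

lemma ae_notMem_frontier (M : TriangularModel Ω E k) (P : Measure Ω) [IsProbabilityMeasure P]
    (K : Kernel (ℝ × ℝ × Covariates k) E) [IsMarkovKernel K] {y : ℝ}
    (h : ∀ᵐ ω ∂P, y ∉ frontier (M.condSuppY K (M.D ω) (M.V P ω) (M.X ω))) :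
    ∀ᵐ w ∂(P.map (M.W P)), y ∉ frontier (M.condSuppY K w.1 w.2.1 w.2.2) := by
  obtain ⟨L, hL⟩ := M.exists_kernel_condLawY K
  have hm := (measurableSet_mem_frontier_support L y).compl
  simp only [hL] at hm
  exact (ae_map_iff (M.measurable_W P).aemeasurable hm).2 h

/-- On almost every fibre over `(V, X)`, almost every `d'` carries the same kernel value. As the
fibre law has no atoms, almost every `d` has positive mass in each interval to its right, so each
such interval contains a good `d'`. The right side is the relevant one because the expansion of `m`
is for positive increments. -/
lemma ae_frequently_kernel_eq [StandardBorelSpace Ω] [StandardBorelSpace E]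
    (M : TriangularModel Ω E k) (P : Measure Ω)
    [IsProbabilityMeasure P] (hC : M.ControlConditions P) (K : Kernel (ℝ × ℝ × Covariates k) E)
    [IsMarkovKernel K] (hK : HasCondDistrib M.ε (M.W P) K P)
    (hD : ∀ᵐ p ∂(P.map fun ω => (M.V P ω, M.X ω)),
      NullSingletonClass (condDistrib M.D (fun ω => (M.V P ω, M.X ω)) P p)) :
    ∀ᵐ w ∂(P.map (M.W P)), ∃ᶠ d' in 𝓝[>] w.1,
      d' ∈ {d' | K (d', w.2) = K w ∧ d' ∈ M.suppD P} := by
  have : Nonempty E := (inferInstance : NeBot (ae P)).nonempty.map M.ε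
  set T : Ω → ℝ × Covariates k := fun ω => (M.V P ω, M.X ω) with hT
  have hTm : Measurable T := (M.measurable_V P).prodMk M.measurable_X
  set κ₀ := condDistrib M.ε T P
  set μ := condDistrib M.D T P
  have hmap : P.map (M.W P) = (P.map T ⊗ₘ μ).map MeasurableEquiv.prodComm := by
    rw [compProd_map_condDistrib M.measurable_D.aemeasurable,
      Measure.map_map MeasurableEquiv.prodComm.measurable (hTm.prodMk M.measurable_D)]
    rfl
  have hgood : ∀ᵐ w ∂(P.map (M.W P)), K w = κ₀ w.2 ∧ w.1 ∈ M.suppD P :=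
    (M.ae_kernel_eq P hC K hK).and ((M.ae_inSupports P).mono fun w hw => hw.1)
  rw [hmap] at hgood ⊢
  rw [MeasurableEquiv.prodComm.measurableEmbedding.ae_map_iff] at hgood ⊢
  have h1 : ∀ᵐ q ∂(P.map T ⊗ₘ μ), ∀ᵐ d ∂(μ q.1), K (d, q.1) = κ₀ q.1 ∧ d ∈ M.suppD P := by
    have h := Measure.ae_ae_of_ae_compProd hgood
    have hfst : P.map T = (P.map T ⊗ₘ μ).map Prod.fst := by
      change P.map T = (P.map T ⊗ₘ μ).fst
      rw [Measure.fst_compProd]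
    rw [hfst] at h
    exact ae_of_ae_map measurable_fst.aemeasurable h
  have h2 : ∀ᵐ q ∂(P.map T ⊗ₘ μ), ∀ c : ℚ, q.2 < (c : ℝ) →
      0 < μ q.1 (Ioo q.2 (c : ℝ)) := by
    refine ae_all_iff.2 fun c => Measure.ae_compProd_of_ae_ae ?_ ?_
    · have hmeas : Measurable fun q : (ℝ × Covariates k) × ℝ => μ q.1 (Ioo q.2 c) :=
        Kernel.measurable_kernel_prodMk_left (κ := μ.prodMkRight ℝ)
          ((measurableSet_lt measurable_fst.snd measurable_snd).inter
            (measurableSet_lt measurable_snd measurable_const) :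
            MeasurableSet {r : ((ℝ × Covariates k) × ℝ) × ℝ | r.1.2 < r.2 ∧ r.2 < c})
      exact (measurableSet_lt measurable_snd measurable_const).himp
        (measurableSet_lt measurable_const hmeas)
    · filter_upwards [hD] with t ht
      exact ae_measure_Ioo_pos (μ t) c
  filter_upwards [hgood, h1, h2] with q hq h1 h2
  rw [frequently_iff]
  intro s hs
  obtain ⟨u, hu, hus⟩ := mem_nhdsGT_iff_exists_Ioo_subset.1 hs
  obtain ⟨c, hc1, hc2⟩ := exists_rat_btwn (show q.2 < u from hu)
  have h3 : ∃ d ∈ Ioo q.2 (c : ℝ), K (d, q.1) = κ₀ q.1 ∧ d ∈ M.suppD P := by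
    by_contra! hcon
    refine (h2 c hc1).ne' (measure_mono_null (fun d hd => ?_) h1)
    simpa only [mem_compl_iff, mem_ofPred_eq, not_and] using hcon d hd
  obtain ⟨d, hd, hKd, hdD⟩ := h3
  exact ⟨d, hus ⟨hd.1, hd.2.trans hc2⟩, hKd.trans hq.1.symm, hdD⟩

section Pointwise

variable {M : TriangularModel Ω E k} {P : Measure Ω}
  {K : Kernel (ℝ × ℝ × Covariates k) E} [IsMarkovKernel K] {y d v : ℝ} {x : Covariates k}
  {f : ℝ → ℝ → ℝ} {G : ℝ → ℝ}

/-- At a good `d + t` the conditional law of `Y` is the image of the unchanged `K (d, v, x)` under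
`m(d + t, x, ·)`, a perturbation of `m(d, x, ·)`. The expansion is used with `s = 0`. -/
lemma dCondCdfY_eq [IsProbabilityMeasure P] (hR3 : M.ConditionalRegular P K)
    (hw : M.InSupports P d v x)
    (hfreq : ∃ᶠ d' in 𝓝[>] d, d' ∈ {d' | K (d', v, x) = K (d, v, x) ∧ d' ∈ M.suppD P})
    (H : DominatedDensity (K (d, v, x)) (M.m d x) (M.dm d x) f G)
    (hc : ∀ y', ContinuousAt (fun u => f u y') y) :
    M.dCondCdfY P K y d v x = -∫ y', y' * f y y' := by
  have hlim := H.tendsto_perturbed hc (Ut := fun t => M.m (d + t) x) (hR3.expansion d v x hw) 0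
  simp only [mul_zero, add_zero, zero_mul, zero_sub] at hlim
  refine derivWithin_eq_of_frequently
    (((hR3.contDiff_condCdf v hw.2.1 x hw.2.2 y).differentiableOn one_ne_zero) d hw.1) hfreq
    (fun d' hd' => hd'.2) (fun t ht => ?_) hlim
  simp only [condCdfY, condLawY]
  rw [ht.1, cdf_map_apply (M.measurable_m_section _ x), cdf_map_apply (M.measurable_m_section _ x)]

/-- The quantile form of the same argument, at the level attained at `y`. -/
lemma betaCQD_eq [IsProbabilityMeasure P] (hR3 : M.ConditionalRegular P K)
    (hw : M.InSupports P d v x)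
    (hfreq : ∃ᶠ d' in 𝓝[>] d, d' ∈ {d' | K (d', v, x) = K (d, v, x) ∧ d' ∈ M.suppD P})
    (H : DominatedDensity (K (d, v, x)) (M.m d x) (M.dm d x) f G)
    (hc : ∀ y', ContinuousAt (fun u => f u y') y) (hy : y ∈ interior (M.condSuppY K d v x))
    (hpos : 0 < ∫ y', f y y') :
    M.betaCQD P K (M.condCdfY K y d v x) d v x = (∫ y', y' * f y y') / ∫ y', f y y' := by
  have : IsProbabilityMeasure (M.condLawY K d v x) :=
    Measure.isProbabilityMeasure_map (M.measurable_m_section d x).aemeasurable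
  have hα := cdf_mem_Ioo_of_mem_interior_support (M.condLawY K d v x) hy
  have hlim := H.tendsto_quantile hc (Ut := fun t => M.m (d + t) x) (hR3.expansion d v x hw)
    (.of_forall fun t => M.measurable_m_section _ x) hα rfl hpos
  refine derivWithin_eq_of_frequently
    ((hR3.differentiable_condQuantile v hw.2.1 x hw.2.2 _ hα) d hw.1) hfreq
    (fun d' hd' => hd'.2) (fun t ht => ?_) hlim
  have h1 : M.condQuantileY K (M.condCdfY K y d v x) d v x = y :=
    quantile_cdf (M.condLawY K d v x) hy
  change M.condQuantileY K (M.condCdfY K y d v x) (d + t) v x -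
    M.condQuantileY K (M.condCdfY K y d v x) d v x = _
  rw [h1]
  simp only [condQuantileY, condCdfY, condLawY]
  rw [ht.1]

lemma matchingSet_eq {τ : ℝ}
    (H : DominatedDensity (K (d, v, x)) (M.m d x) (M.dm d x) f G)
    (hy : M.qY P τ ∈ interior (M.condSuppY K d v x)) :
    M.matchingSet P K τ d v x = {M.condCdfY K (M.qY P τ) d v x} := by
  have : IsProbabilityMeasure (M.condLawY K d v x) :=
    Measure.isProbabilityMeasure_map (M.measurable_m_section d x).aemeasurable
  have : NullSingletonClass (M.condLawY K d v x) := H.nullSingletonClass_map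
  exact setOf_quantile_eq (M.condLawY K d v x) hy

lemma zeta_eq {τ : ℝ}
    (H : DominatedDensity (K (d, v, x)) (M.m d x) (M.dm d x) f G)
    (hy : M.qY P τ ∈ interior (M.condSuppY K d v x)) :
    M.zeta P K τ d v x = M.condCdfY K (M.qY P τ) d v x := by
  rw [zeta, matchingSet_eq H hy, csSup_singleton]

end Pointwise

/-- What the assumptions give, for almost every `(d, v, x)`, about the conditional distribution of
the outcome near a fixed `y`. -/
structure LocalRegular (M : TriangularModel Ω E k) (P : Measure Ω)
    (K : Kernel (ℝ × ℝ × Covariates k) E) (y : ℝ) (G : ℝ → ℝ) (w : ℝ × ℝ × Covariates k)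
    (f : ℝ → ℝ → ℝ) : Prop where
  density : DominatedDensity (K w) (M.m w.1 w.2.2) (M.dm w.1 w.2.2) f G
  continuousAt : ∀ y', ContinuousAt (fun u => f u y') y
  condDensityY_eq : M.condDensityY K y w.1 w.2.1 w.2.2 = ∫ y', f y y'
  continuousAt_condDensityY : ContinuousAt (fun u => M.condDensityY K u w.1 w.2.1 w.2.2) y
  dCondCdfY_eq : M.dCondCdfY P K y w.1 w.2.1 w.2.2 = -∫ y', y' * f y y'
  matchingSet_eq : ∀ τ, M.qY P τ = y → M.condDensityY K y w.1 w.2.1 w.2.2 ≠ 0 →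
    M.matchingSet P K τ w.1 w.2.1 w.2.2 = {M.zeta P K τ w.1 w.2.1 w.2.2}
  condDensityY_mul_betaCQD : ∀ τ, M.qY P τ = y → M.condDensityY K y w.1 w.2.1 w.2.2 *
    M.betaCQD P K (M.zeta P K τ w.1 w.2.1 w.2.2) w.1 w.2.1 w.2.2 = ∫ y', y' * f y y'

lemma exists_ae_localRegular [StandardBorelSpace Ω] [StandardBorelSpace E]
    (M : TriangularModel Ω E k) (P : Measure Ω) [IsProbabilityMeasure P]
    (K : Kernel (ℝ × ℝ × Covariates k) E) [IsMarkovKernel K]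
    (hK : HasCondDistrib M.ε (M.W P) K P)
    (hD : ∀ᵐ p ∂(P.map fun ω => (M.V P ω, M.X ω)),
      NullSingletonClass (condDistrib M.D (fun ω => (M.V P ω, M.X ω)) P p))
    (hC : M.ControlConditions P) (hR3 : M.ConditionalRegular P K)
    (hfrontier : ∀ y ∈ interior (M.suppY P),
      ∀ᵐ ω ∂P, y ∉ frontier (M.condSuppY K (M.D ω) (M.V P ω) (M.X ω))) :
    ∃ G : ℝ → ℝ, Integrable G ∧ (Integrable fun y' => y' * G y') ∧
      ∀ y ∈ interior (M.suppY P), ∀ᵐ w ∂(P.map (M.W P)), ∃ f, M.LocalRegular P K y G w f := by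
  obtain ⟨G, hG⟩ := M.exists_dominatedDensity_cond P K hR3
  have : IsProbabilityMeasure (P.map (M.W P)) :=
    Measure.isProbabilityMeasure_map (M.measurable_W P).aemeasurable
  -- The integrability of `G` is read off from the conditional density at any one point of the
  -- supports.
  obtain ⟨w₀, hw₀⟩ := (M.ae_inSupports P).exists
  obtain ⟨f₀, hf₀, -⟩ := hG _ _ _ hw₀
  refine ⟨G, hf₀.integrable, hf₀.integrable_mul, fun y hy => ?_⟩
  filter_upwards [M.ae_inSupports P, M.ae_frequently_kernel_eq P hC K hK hD,
    M.ae_notMem_frontier P K (hfrontier y hy)]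
  rintro ⟨d, v, x⟩ hw hfreq hfr
  simp only at hw hfreq hfr
  obtain ⟨f, H, hc, h0⟩ := hG d v x hw
  have hdens := fun u hu => M.condDensityY_eq_integral hR3 (y := u) hw H hc h0 hu
  have hB := TriangularModel.dCondCdfY_eq hR3 hw hfreq H (hc y hfr)
  refine ⟨f, H, hc y hfr, hdens y hfr, ?_, hB, ?_, ?_⟩
  · refine (H.continuousAt_integral (hc y hfr)).congr ?_
    filter_upwards [isClosed_frontier.isOpen_compl.mem_nhds hfr] with u hu
    exact (hdens u hu).symm
  all_goals
    intro τ hτ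
    -- Off the frontier, `y` is interior to the conditional support or outside it, where the density
    -- and its first moment vanish, so the value of `zeta` is irrelevant.
    by_cases hp : y ∈ M.condSuppY K d v x
  · have hi : M.qY P τ ∈ interior (M.condSuppY K d v x) := by
      by_contra h
      exact hfr ⟨subset_closure hp, hτ ▸ h⟩
    intro _
    rw [TriangularModel.matchingSet_eq H hi, zeta_eq H hi]
  · exact fun h => absurd (M.condDensityY_eq_zero hp) h
  · have hi : M.qY P τ ∈ interior (M.condSuppY K d v x) := by
      by_contra h
      exact hfr ⟨subset_closure hp, hτ ▸ h⟩
    have hpos := hR3.density_pos d v x hw _ hi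
    rw [hτ, hdens y hfr] at hpos
    rw [zeta_eq H hi, hτ, betaCQD_eq hR3 hw hfreq H (hc y hfr) (hτ ▸ hi) hpos, hdens y hfr,
      mul_div_cancel₀ _ hpos.ne']
  · rw [M.condDensityY_eq_zero hp, zero_mul]
    simp [h0 y hp]

end TriangularModel

/-! ### From conditional to marginal quantities -/

/-- Averages over thin level strips of `U`, computed through a disintegration. -/
lemma ProbabilityTheory.HasCondDistrib.tendsto_average {Ω T E : Type*} [MeasurableSpace Ω]
    [MeasurableSpace T] [MeasurableSpace E] {P : Measure Ω} [IsProbabilityMeasure P] {W : Ω → T}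
    {ε : Ω → E} {K : Kernel T E} [IsMarkovKernel K] (hK : HasCondDistrib ε W K P)
    {U R : T × E → ℝ} (hU : Measurable U) (hR : Measurable R) {y C : ℝ} {L : T → ℝ}
    (hlim : ∀ᵐ w ∂(P.map W), Tendsto (fun h : ℝ =>
      h⁻¹ * ∫ e in {e | U (w, e) ∈ Ioc y (y + h)}, R (w, e) ∂(K w)) (𝓝[>] 0) (𝓝 (L w)))
    (hbound : ∀ᵐ w ∂(P.map W), ∀ h : ℝ, 0 < h →
      |h⁻¹ * ∫ e in {e | U (w, e) ∈ Ioc y (y + h)}, R (w, e) ∂(K w)| ≤ C)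
    (hint : ∀ h : ℝ, 0 < h → IntegrableOn (fun ω => R (W ω, ε ω))
      {ω | U (W ω, ε ω) ∈ Ioc y (y + h)} P) :
    AEStronglyMeasurable L (P.map W) ∧
      Tendsto (fun h : ℝ => h⁻¹ * ∫ ω in {ω | U (W ω, ε ω) ∈ Ioc y (y + h)}, R (W ω, ε ω) ∂P)
        (𝓝[>] 0) (𝓝 (∫ w, L w ∂(P.map W))) := by
  have := Measure.isProbabilityMeasure_map hK.aemeasurable_fst
  have hS : ∀ h : ℝ, MeasurableSet (U ⁻¹' Ioc y (y + h)) := fun h => hU measurableSet_Ioc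
  have hSR : ∀ h : ℝ, Measurable ((U ⁻¹' Ioc y (y + h)).indicator R) := fun h =>
    hR.indicator (hS h)
  have hin : ∀ h : ℝ, ∀ w, ∫ e in {e | U (w, e) ∈ Ioc y (y + h)}, R (w, e) ∂(K w) =
      ∫ e, (U ⁻¹' Ioc y (y + h)).indicator R (w, e) ∂(K w) := fun h w => by
    have hset : MeasurableSet {e | U (w, e) ∈ Ioc y (y + h)} := measurable_prodMk_left (hS h)
    rw [← integral_indicator hset]
    rfl
  have hmeas : ∀ h : ℝ, StronglyMeasurable fun w =>
      h⁻¹ * ∫ e in {e | U (w, e) ∈ Ioc y (y + h)}, R (w, e) ∂(K w) := fun h => by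
    simp only [hin]
    exact (hSR h).stronglyMeasurable.integral_kernel_prod_right'.const_mul _
  refine ⟨aestronglyMeasurable_of_tendsto_ae _ (fun h => (hmeas h).aestronglyMeasurable) hlim, ?_⟩
  have hmain : Tendsto (fun h : ℝ => ∫ w,
      h⁻¹ * ∫ e in {e | U (w, e) ∈ Ioc y (y + h)}, R (w, e) ∂(K w) ∂(P.map W)) (𝓝[>] 0)
      (𝓝 (∫ w, L w ∂(P.map W))) := by
    refine tendsto_integral_filter_of_dominated_convergence (fun _ => C)
      (.of_forall fun h => (hmeas h).aestronglyMeasurable) ?_ (integrable_const _) hlim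
    filter_upwards [self_mem_nhdsWithin] with h hh
    filter_upwards [hbound] with w hw
    exact hw h hh
  refine hmain.congr' ?_
  filter_upwards [self_mem_nhdsWithin] with h hh
  have hpair := hK.aemeasurable
  have hnull : NullMeasurableSet {ω | U (W ω, ε ω) ∈ Ioc y (y + h)} P :=
    hpair.nullMeasurableSet_preimage (hS h)
  have hI : Integrable ((U ⁻¹' Ioc y (y + h)).indicator R) (P.map W ⊗ₘ K) := by
    rw [← hK.map_eq, integrable_map_measure (hSR h).aestronglyMeasurable hpair]
    exact (hint h hh).integrable_indicator₀ hnull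
  simp only [hin]
  rw [integral_const_mul, ← Measure.integral_compProd hI, ← hK.map_eq,
    integral_map hpair (hSR h).aestronglyMeasurable, ← integral_indicator₀ hnull]
  rfl

namespace TriangularModel

variable {Ω E : Type*} [MeasurableSpace Ω] [MeasurableSpace E] {k : ℕ}

/-- Used with `ψ` an indicator and `φ = 1` for conditional densities, and with `ψ = π̇` and `φ = id`
for effects. The bound on the averages is uniform in `w` because `G` is. -/
lemma tendsto_weighted_average {M : TriangularModel Ω E k} {P : Measure Ω} [IsProbabilityMeasure P]
    {K : Kernel (ℝ × ℝ × Covariates k) E} [IsMarkovKernel K]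
    (hK : HasCondDistrib M.ε (M.W P) K P) {G : ℝ → ℝ} {y : ℝ}
    (hloc : ∀ᵐ w ∂(P.map (M.W P)), ∃ f, M.LocalRegular P K y G w f)
    {ψ : ℝ × ℝ × Covariates k → ℝ} (hψ : Measurable ψ) {B : ℝ} (hB : ∀ w, |ψ w| ≤ B)
    {φ : ℝ → ℝ} (hφ : Measurable φ) (hG : Integrable fun y' => φ y' * G y')
    (hint : ∀ h : ℝ, 0 < h → IntegrableOn
      (fun ω => ψ (M.W P ω) * φ (M.dm (M.D ω) (M.X ω) (M.ε ω))) (M.Y ⁻¹' Ioc y (y + h)) P)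
    {L : ℝ × ℝ × Covariates k → ℝ}
    (hL : ∀ w f, M.LocalRegular P K y G w f → L w = ψ w * ∫ y', φ y' * f y y') :
    AEStronglyMeasurable L (P.map (M.W P)) ∧
      Tendsto (fun h : ℝ => h⁻¹ * ∫ ω in M.Y ⁻¹' Ioc y (y + h),
        ψ (M.W P ω) * φ (M.dm (M.D ω) (M.X ω) (M.ε ω)) ∂P) (𝓝[>] 0)
        (𝓝 (∫ w, L w ∂(P.map (M.W P)))) := by
  have hp : Measurable fun p : (ℝ × ℝ × Covariates k) × E => (p.1.1, p.1.2.2, p.2) :=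
    measurable_fst.fst.prodMk (measurable_fst.snd.snd.prodMk measurable_snd)
  refine hK.tendsto_average (U := fun p => M.m p.1.1 p.1.2.2 p.2)
    (R := fun p => ψ p.1 * φ (M.dm p.1.1 p.1.2.2 p.2)) (M.measurable_m.comp hp)
    ((hψ.comp measurable_fst).mul (hφ.comp (M.measurable_dm.comp hp)))
    (C := B * ∫ y', |φ y' * G y'|) ?_ ?_ hint
  · filter_upwards [hloc] with w ⟨f, hf⟩
    rw [hL w f hf]
    refine ((hf.density.tendsto_strip hφ hG hf.continuousAt).const_mul (ψ w)).congr fun h => ?_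
    rw [integral_const_mul, mul_left_comm]
    rfl
  · filter_upwards [hloc] with w ⟨f, hf⟩
    intro h hh
    rw [integral_const_mul, mul_left_comm, abs_mul]
    exact mul_le_mul (hB w) (hf.density.strip_bound hφ hG y h hh) (abs_nonneg _)
      ((abs_nonneg _).trans (hB w))

section Outcome

variable {M : TriangularModel Ω E k} {P : Measure Ω} {K : Kernel (ℝ × ℝ × Covariates k) E}
  {G : ℝ → ℝ} {y : ℝ}

lemma LocalRegular.condDensityY_nonneg {w : ℝ × ℝ × Covariates k} {f : ℝ → ℝ → ℝ}
    (hf : M.LocalRegular P K y G w f) : 0 ≤ M.condDensityY K y w.1 w.2.1 w.2.2 := by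
  rw [hf.condDensityY_eq]
  exact integral_nonneg fun y' => hf.density.nonneg _ _

lemma LocalRegular.condDensityY_le {w : ℝ × ℝ × Covariates k} {f : ℝ → ℝ → ℝ}
    (hf : M.LocalRegular P K y G w f) : M.condDensityY K y w.1 w.2.1 w.2.2 ≤ ∫ y', G y' := by
  rw [hf.condDensityY_eq]
  exact integral_mono (hf.density.integrable_section y) hf.density.integrable
    fun y' => hf.density.le _ _

lemma LocalRegular.abs_dCondCdfY_le {w : ℝ × ℝ × Covariates k} {f : ℝ → ℝ → ℝ}
    (hf : M.LocalRegular P K y G w f) :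
    |M.dCondCdfY P K y w.1 w.2.1 w.2.2| ≤ ∫ y', |y' * G y'| := by
  rw [hf.dCondCdfY_eq, abs_neg, ← Real.norm_eq_abs]
  simp only [← Real.norm_eq_abs]
  refine norm_integral_le_of_norm_le hf.density.integrable_mul.norm
    (.of_forall fun y' => ?_)
  rw [norm_mul, norm_mul, Real.norm_of_nonneg (hf.density.nonneg _ _),
    Real.norm_of_nonneg (hf.density.dominating_nonneg _)]
  exact mul_le_mul_of_nonneg_left (hf.density.le _ _) (norm_nonneg _)

variable [IsProbabilityMeasure P] [IsMarkovKernel K]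

lemma tendsto_average_condDensityY (hK : HasCondDistrib M.ε (M.W P) K P) (hGi : Integrable G)
    (hloc : ∀ᵐ w ∂(P.map (M.W P)), ∃ f, M.LocalRegular P K y G w f)
    {B : Set (ℝ × ℝ × Covariates k)} (hB : MeasurableSet B) :
    Tendsto (fun h : ℝ => h⁻¹ * P.real (M.Y ⁻¹' Ioc y (y + h) ∩ M.W P ⁻¹' B)) (𝓝[>] 0)
      (𝓝 (∫ w in B, M.condDensityY K y w.1 w.2.1 w.2.2 ∂(P.map (M.W P)))) := by
  have hψ : Measurable (B.indicator fun _ => (1 : ℝ)) := measurable_const.indicator hB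
  have h := (tendsto_weighted_average hK hloc hψ (B := 1)
    (fun w => by by_cases hw : w ∈ B <;> simp [hw]) (φ := fun _ => 1) measurable_const
    (by simpa using hGi) (fun h _ => ?_)
    (L := B.indicator fun w => M.condDensityY K y w.1 w.2.1 w.2.2) (fun w f hf => ?_)).2
  · rw [integral_indicator hB] at h
    refine h.congr fun t => ?_
    have h1 : (fun ω => B.indicator (fun _ => (1 : ℝ)) (M.W P ω) * 1) =
        (M.W P ⁻¹' B).indicator fun _ => (1 : ℝ) := by
      ext ω
      rw [mul_one]
      rfl
    rw [h1, integral_indicator (M.measurable_W P hB), setIntegral_const, smul_eq_mul, mul_one,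
      measureReal_restrict_apply (M.measurable_W P hB), inter_comm]
  · simp only [mul_one]
    exact ((integrable_const (1 : ℝ)).indicator (M.measurable_W P hB)).integrableOn
  · by_cases hw : w ∈ B
    · simp [hw, hf.condDensityY_eq]
    · simp [hw]

lemma aestronglyMeasurable_condDensityY (hK : HasCondDistrib M.ε (M.W P) K P) (hGi : Integrable G)
    (hloc : ∀ᵐ w ∂(P.map (M.W P)), ∃ f, M.LocalRegular P K y G w f) :
    AEStronglyMeasurable (fun w : ℝ × ℝ × Covariates k => M.condDensityY K y w.1 w.2.1 w.2.2)
      (P.map (M.W P)) :=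
  (tendsto_weighted_average hK hloc (ψ := fun _ => 1) measurable_const (B := 1)
    (fun w => by simp) (φ := fun _ => 1) measurable_const
    (by simpa using hGi) (fun h _ => by simp) (fun w f hf => by simp [hf.condDensityY_eq])).1

/-- The marginal density of the outcome is the mean of the conditional densities. -/
lemma integral_condDensityY (hR1 : M.OutcomeRegular P) (hK : HasCondDistrib M.ε (M.W P) K P)
    (hGi : Integrable G) (hy : y ∈ interior (M.suppY P))
    (hloc : ∀ᵐ w ∂(P.map (M.W P)), ∃ f, M.LocalRegular P K y G w f) :
    ∫ w, M.condDensityY K y w.1 w.2.1 w.2.2 ∂(P.map (M.W P)) = M.fY P y := by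
  have h1 := tendsto_average_condDensityY hK hGi hloc MeasurableSet.univ
  rw [setIntegral_univ] at h1
  have hd : DifferentiableAt ℝ (cdf (P.map M.Y)) y :=
    differentiableAt_of_deriv_ne_zero (hR1.density_pos y hy).ne'
  refine tendsto_nhds_unique h1 (hd.hasDerivAt.tendsto_slope_zero_right.congr' ?_)
  have := Measure.isProbabilityMeasure_map (μ := P) M.measurable_Y.aemeasurable
  filter_upwards [self_mem_nhdsWithin] with h hh
  have hh' : (0 : ℝ) < h := hh
  rw [cdf_sub_cdf _ (by linarith), map_measureReal_apply M.measurable_Y measurableSet_Ioc,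
    preimage_univ, inter_univ, smul_eq_mul]

/-- The mean of the conditional effects is the effect in the joint density of the outcome and its
response. -/
lemma integral_policyDot_mul_dCondCdfY (hK : HasCondDistrib M.ε (M.W P) K P)
    (hGi : Integrable fun y' => y' * G y') {f₀ : ℝ → ℝ → ℝ} {G₀ : ℝ → ℝ}
    (H : DominatedDensity P M.Y (fun ω => M.mDot (M.D ω) (M.X ω) (M.ε ω)) f₀ G₀)
    (hc : ∀ y', ContinuousAt (fun u => f₀ u y') y)
    (hloc : ∀ᵐ w ∂(P.map (M.W P)), ∃ f, M.LocalRegular P K y G w f) :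
    Integrable (fun w : ℝ × ℝ × Covariates k =>
        M.policyDot w.1 * M.dCondCdfY P K y w.1 w.2.1 w.2.2) (P.map (M.W P)) ∧
      ∫ w, M.policyDot w.1 * M.dCondCdfY P K y w.1 w.2.1 w.2.2 ∂(P.map (M.W P)) =
        -∫ y', y' * f₀ y y' := by
  obtain ⟨B, hB0, hB⟩ := M.exists_policyDot_bound
  have := Measure.isProbabilityMeasure_map (μ := P) (M.measurable_W P).aemeasurable
  obtain ⟨h1, h2⟩ := tendsto_weighted_average hK hloc (ψ := fun w => M.policyDot w.1)
    (M.measurable_policyDot.comp measurable_fst) (fun w => hB w.1) (φ := fun y' => y')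
    -- The product `π̇ ∂_d m` is the policy response, whose integrability on strips comes from the
    -- joint density of the marginal problem.
    measurable_id hGi (fun h _ =>
      H.integrableOn_strip (φ := fun y' => y') measurable_id H.integrable_mul y (y + h))
    (L := fun w => -(M.policyDot w.1 * M.dCondCdfY P K y w.1 w.2.1 w.2.2))
    (fun w f hf => by rw [hf.dCondCdfY_eq, mul_neg, neg_neg])
  refine ⟨Integrable.of_bound (C := B * ∫ y', |y' * G y'|)
    (h1.neg.congr (.of_forall fun w => neg_neg _)) ?_, ?_⟩
  · filter_upwards [hloc] with w ⟨f, hf⟩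
    rw [norm_mul]
    exact mul_le_mul (hB w.1) hf.abs_dCondCdfY_le (norm_nonneg _) hB0
  · have h3 := H.tendsto_strip (φ := fun y' => y') measurable_id H.integrable_mul hc
    have h4 := tendsto_nhds_unique h2 h3
    rw [integral_neg] at h4
    rw [← h4, neg_neg]

lemma continuousAt_integral_mul_condDensityY (hK : HasCondDistrib M.ε (M.W P) K P)
    (hGi : Integrable G)
    (hloc : ∀ y ∈ interior (M.suppY P), ∀ᵐ w ∂(P.map (M.W P)), ∃ f, M.LocalRegular P K y G w f)
    (hy : y ∈ interior (M.suppY P)) {φ : ℝ × ℝ × Covariates k → ℝ} (hφ : Measurable φ) {B : ℝ}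
    (hB : ∀ w, |φ w| ≤ B) :
    ContinuousAt (fun u => ∫ w, φ w * M.condDensityY K u w.1 w.2.1 w.2.2 ∂(P.map (M.W P))) y := by
  have := Measure.isProbabilityMeasure_map (μ := P) (M.measurable_W P).aemeasurable
  have hnear := isOpen_interior.mem_nhds hy
  refine tendsto_integral_filter_of_dominated_convergence (fun _ => B * ∫ y', G y') ?_ ?_
    (integrable_const _) ?_
  · filter_upwards [hnear] with u hu
    exact hφ.aestronglyMeasurable.mul (aestronglyMeasurable_condDensityY hK hGi (hloc u hu))
  · filter_upwards [hnear] with u hu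
    filter_upwards [hloc u hu] with w ⟨f, hf⟩
    rw [norm_mul, Real.norm_of_nonneg hf.condDensityY_nonneg]
    exact mul_le_mul (hB w) hf.condDensityY_le hf.condDensityY_nonneg
      ((abs_nonneg _).trans (hB w))
  · filter_upwards [hloc y hy] with w ⟨f, hf⟩
    exact hf.continuousAt_condDensityY.const_mul _

end Outcome

end TriangularModel

/-! ### The weakly continuous conditional law given the outcome -/

/-- A finite measure on an interval is determined by the right derivative of its distribution
function. -/
lemma eq_withDensity_of_tendsto_average {ν : Measure ℝ} [IsFiniteMeasure ν] [NullSingletonClass ν]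
    {a b : ℝ} (hab : a < b) (hsupp : ν (Icc a b)ᶜ = 0) {c : ℝ → ℝ} {B : ℝ}
    (hc : ContinuousOn c (Ioo a b)) (hc0 : ∀ y ∈ Ioo a b, 0 ≤ c y) (hcB : ∀ y ∈ Ioo a b, c y ≤ B)
    (hlim : ∀ y ∈ Ioo a b, Tendsto (fun h : ℝ => h⁻¹ * ν.real (Ioc y (y + h))) (𝓝[>] 0)
      (𝓝 (c y))) :
    ν = (volume.restrict (Ioo a b)).withDensity fun y => ENNReal.ofReal (c y) := by
  have hci : IntegrableOn c (Ioo a b) := by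
    refine Integrable.of_bound (C := B) (hc.aestronglyMeasurable measurableSet_Ioo) ?_
    filter_upwards [ae_restrict_mem measurableSet_Ioo] with y hy
    rw [Real.norm_of_nonneg (hc0 y hy)]
    exact hcB y hy
  have hone : Integrable (fun _ : ℝ => (1 : ℝ)) ν := integrable_const 1
  have hprim : ∀ y z : ℝ, y ≤ z → ∫ _ in y..z, (1 : ℝ) ∂ν = ν.real (Ioc y z) := fun y z h => by
    rw [intervalIntegral.integral_of_le h, setIntegral_const, smul_eq_mul, mul_one]
  have hcut : ∀ u ∈ Icc a b, ∫ y in a..u, c y = ν.real (Ioc a u) := by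
    intro u hu
    rw [← hprim a u hu.1]
    have hci' : IntervalIntegrable c volume a u :=
      (intervalIntegrable_iff_integrableOn_Ioo_of_le hu.1).2
        (hci.mono_set (Ioo_subset_Ioo_right hu.2))
    -- The fundamental theorem needs only a right derivative, provided the primitive is continuous,
    -- which the absence of atoms ensures.
    have h := intervalIntegral.integral_eq_sub_of_hasDeriv_right_of_le (f' := c) hu.1
      (hone.continuous_primitive a).continuousOn (fun y hy => ?_) hci'
    · rw [h, intervalIntegral.integral_same, sub_zero]
    · have hyab : y ∈ Ioo a b := ⟨hy.1, hy.2.trans_le hu.2⟩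
      rw [hasDerivWithinAt_iff_tendsto_slope' (by simp)]
      have hshift : Tendsto (fun z => z - y) (𝓝[>] y) (𝓝[>] 0) := by
        refine tendsto_nhdsWithin_iff.2 ⟨?_, ?_⟩
        · have : Tendsto (fun z => z - y) (𝓝 y) (𝓝 (y - y)) := tendsto_id.sub_const y
          rw [sub_self] at this
          exact this.mono_left nhdsWithin_le_nhds
        · filter_upwards [self_mem_nhdsWithin] with z hz
          exact sub_pos.2 (show y < z from hz)
      refine ((hlim y hyab).comp hshift).congr' ?_
      filter_upwards [self_mem_nhdsWithin] with z hz
      rw [Function.comp_apply, add_sub_cancel, slope_def_field, ← hprim y z (le_of_lt hz),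
        intervalIntegral.integral_interval_sub_left hone.intervalIntegrable
          hone.intervalIntegrable, div_eq_inv_mul]
  -- Clamping `v` to `[a, b]` does not change the half-line within `(a, b)`, which carries both
  -- measures.
  have hset : ∀ v : ℝ, Ioc a (max a (min v b)) ∩ Ioo a b = Iic v ∩ Ioo a b := by
    intro v
    ext y
    simp only [mem_inter_iff, mem_Ioc, mem_Iic, mem_Ioo, le_max_iff, le_min_iff]
    constructor
    · rintro ⟨⟨h1, h2 | h2⟩, h3⟩
      · exact absurd h1 (not_lt.2 h2)
      · exact ⟨h2.1, h3⟩
    · rintro ⟨h1, h2⟩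
      exact ⟨⟨h2.1, Or.inr ⟨h1, h2.2.le⟩⟩, h2⟩
  have hae : ∀ (ρ : Measure ℝ), ρ (Icc a b)ᶜ = 0 → (∀ x, ρ {x} = 0) → ∀ᵐ y ∂ρ, y ∈ Ioo a b := by
    intro ρ h1 h2
    filter_upwards [measure_eq_zero_iff_ae_notMem.1 h1, measure_eq_zero_iff_ae_notMem.1 (h2 a),
      measure_eq_zero_iff_ae_notMem.1 (h2 b)] with y hy hya hyb
    rw [mem_compl_iff, not_not] at hy
    exact ⟨lt_of_le_of_ne hy.1 (Ne.symm hya), lt_of_le_of_ne hy.2 hyb⟩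
  refine Measure.ext_of_Iic _ _ fun v => ?_
  set u := max a (min v b) with hu
  have hu_mem : u ∈ Icc a b := ⟨le_max_left _ _, max_le hab.le (min_le_right _ _)⟩
  have h1 : ν (Iic v) = ν (Ioc a u) := by
    refine measure_congr ?_
    filter_upwards [hae ν hsupp measure_singleton] with y hy
    have := Set.ext_iff.1 (hset v) y
    simp only [mem_inter_iff, hy, and_true] at this
    exact propext this.symm
  have h2 : (Iic v ∩ Ioo a b : Set ℝ) =ᵐ[volume] Ioc a u := by
    rw [← hset v]
    have h3 : (Ioc a u ∩ Ioo a b : Set ℝ) =ᵐ[volume] (Ioc a u ∩ Ioc a b : Set ℝ) :=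
      (ae_eq_refl (Ioc a u)).inter Ioo_ae_eq_Ioc
    rwa [inter_eq_left.2 (Ioc_subset_Ioc_right hu_mem.2)] at h3
  rw [withDensity_apply _ measurableSet_Iic, Measure.restrict_restrict measurableSet_Iic,
    Measure.restrict_congr_set h2, h1, ← ofReal_measureReal, ← hcut u hu_mem,
    intervalIntegral.integral_of_le hu_mem.1]
  have hcc : ∀ᵐ y ∂(volume.restrict (Ioc a u)), 0 ≤ c y := by
    rw [← Measure.restrict_congr_set h2]
    filter_upwards [ae_restrict_mem (measurableSet_Iic.inter measurableSet_Ioo)] with y hy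
    exact hc0 y hy.2
  refine ofReal_integral_eq_lintegral_ofReal ?_ hcc
  have hci' : IntegrableOn c (Icc a b) := by rwa [integrableOn_Icc_iff_integrableOn_Ioo]
  refine hci'.mono_set ?_
  exact Ioc_subset_Icc_self.trans (Icc_subset_Icc_right hu_mem.2)

namespace TriangularModel

variable {Ω E : Type*} [MeasurableSpace Ω] [MeasurableSpace E] {k : ℕ}
  {M : TriangularModel Ω E k} {P : Measure Ω} {K : Kernel (ℝ × ℝ × Covariates k) E} {G : ℝ → ℝ}

lemma weight_nonneg (hR1 : M.OutcomeRegular P) {y : ℝ} (hy : y ∈ interior (M.suppY P))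
    {w : ℝ × ℝ × Covariates k} {f : ℝ → ℝ → ℝ} (hf : M.LocalRegular P K y G w f) :
    0 ≤ M.weight P K y w.1 w.2.1 w.2.2 :=
  div_nonneg hf.condDensityY_nonneg (hR1.density_pos y hy).le

variable [IsProbabilityMeasure P] [IsMarkovKernel K]

lemma setIntegral_condDensityY_continuousOn (hK : HasCondDistrib M.ε (M.W P) K P)
    (hGi : Integrable G)
    (hloc : ∀ y ∈ interior (M.suppY P), ∀ᵐ w ∂(P.map (M.W P)), ∃ f, M.LocalRegular P K y G w f)
    {B : Set (ℝ × ℝ × Covariates k)} (hB : MeasurableSet B) :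
    ContinuousOn (fun y => ∫ w in B, M.condDensityY K y w.1 w.2.1 w.2.2 ∂(P.map (M.W P)))
      (interior (M.suppY P)) := by
  intro y hy
  have h := continuousAt_integral_mul_condDensityY hK hGi hloc hy
    (measurable_const.indicator hB : Measurable (B.indicator fun _ => (1 : ℝ))) (B := 1)
    (fun w => by by_cases hw : w ∈ B <;> simp [hw])
  refine ContinuousAt.continuousWithinAt (h.congr (.of_forall fun u => ?_))
  simp only
  rw [← integral_indicator hB]
  refine integral_congr_ae (.of_forall fun w => ?_)
  by_cases hw : w ∈ B <;> simp [hw]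

lemma integrable_condDensityY (hK : HasCondDistrib M.ε (M.W P) K P) (hGi : Integrable G) {y : ℝ}
    (hloc : ∀ᵐ w ∂(P.map (M.W P)), ∃ f, M.LocalRegular P K y G w f) :
    Integrable (fun w : ℝ × ℝ × Covariates k => M.condDensityY K y w.1 w.2.1 w.2.2)
      (P.map (M.W P)) := by
  have := Measure.isProbabilityMeasure_map (μ := P) (M.measurable_W P).aemeasurable
  refine Integrable.of_bound (C := ∫ y', G y') (aestronglyMeasurable_condDensityY hK hGi hloc) ?_
  filter_upwards [hloc] with w ⟨f, hf⟩
  rw [Real.norm_of_nonneg hf.condDensityY_nonneg]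
  exact hf.condDensityY_le

lemma weight_withDensity_apply (hR1 : M.OutcomeRegular P) (hK : HasCondDistrib M.ε (M.W P) K P)
    (hGi : Integrable G) {y : ℝ} (hy : y ∈ interior (M.suppY P))
    (hloc : ∀ᵐ w ∂(P.map (M.W P)), ∃ f, M.LocalRegular P K y G w f)
    {B : Set (ℝ × ℝ × Covariates k)} (hB : MeasurableSet B) :
    (P.map (M.W P)).withDensity
        (fun w => ENNReal.ofReal (M.weight P K y w.1 w.2.1 w.2.2)) B =
      ENNReal.ofReal ((∫ w in B, M.condDensityY K y w.1 w.2.1 w.2.2 ∂(P.map (M.W P))) /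
        M.fY P y) := by
  rw [withDensity_apply _ hB, ← ofReal_integral_eq_lintegral_ofReal]
  · simp only [weight, integral_div]
  · exact ((integrable_condDensityY hK hGi hloc).div_const _).integrableOn
  · refine ae_restrict_of_ae ?_
    filter_upwards [hloc] with w ⟨f, hf⟩
    exact weight_nonneg hR1 hy hf

/-- The weights, as densities, give the continuous version of the conditional distribution of
`(D, V, X)` given the outcome. -/
lemma exists_kernel_weight (hR1 : M.OutcomeRegular P) (hK : HasCondDistrib M.ε (M.W P) K P)
    (hGi : Integrable G)
    (hloc : ∀ y ∈ interior (M.suppY P), ∀ᵐ w ∂(P.map (M.W P)), ∃ f, M.LocalRegular P K y G w f) :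
    ∃ κ : Kernel ℝ (ℝ × ℝ × Covariates k), IsMarkovKernel κ ∧ ∀ y ∈ interior (M.suppY P),
      κ y = (P.map (M.W P)).withDensity
        fun w => ENNReal.ofReal (M.weight P K y w.1 w.2.1 w.2.2) := by
  classical
  have := Measure.isProbabilityMeasure_map (μ := P) (M.measurable_W P).aemeasurable
  let κ : Kernel ℝ (ℝ × ℝ × Covariates k) :=
    -- Outside the interior any fixed probability measure serves. Inside, measurability in `y` comes
    -- from continuity of the integrated conditional density.
    { toFun := fun y => if y ∈ interior (M.suppY P) then (P.map (M.W P)).withDensity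
        (fun w => ENNReal.ofReal (M.weight P K y w.1 w.2.1 w.2.2)) else P.map (M.W P)
      measurable' := by
        refine Measure.measurable_of_measurable_coe _ fun B hB => ?_
        have h1 : (fun y => (if y ∈ interior (M.suppY P) then (P.map (M.W P)).withDensity
            (fun w => ENNReal.ofReal (M.weight P K y w.1 w.2.1 w.2.2)) else P.map (M.W P)) B) =
            fun y => if y ∈ interior (M.suppY P) then ENNReal.ofReal
              (((interior (M.suppY P)).piecewise (fun y => ∫ w in B,
                M.condDensityY K y w.1 w.2.1 w.2.2 ∂(P.map (M.W P))) 0) y / M.fY P y)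
              else P.map (M.W P) B := by
          ext y
          by_cases hy : y ∈ interior (M.suppY P)
          · rw [if_pos hy, if_pos hy, weight_withDensity_apply hR1 hK hGi hy (hloc y hy) hB,
              piecewise_eq_of_mem _ _ _ hy]
          · rw [if_neg hy, if_neg hy]
        rw [h1]
        refine Measurable.ite isOpen_interior.measurableSet ?_ measurable_const
        refine (Measurable.div ?_ (measurable_deriv _)).ennreal_ofReal
        exact (setIntegral_condDensityY_continuousOn hK hGi hloc hB).measurable_piecewise
          continuousOn_const isOpen_interior.measurableSet }
  refine ⟨κ, ⟨fun y => ⟨?_⟩⟩, fun y hy => if_pos hy⟩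
  by_cases hy : y ∈ interior (M.suppY P)
  · rw [show κ y = _ from if_pos hy,
      weight_withDensity_apply hR1 hK hGi hy (hloc y hy) MeasurableSet.univ, setIntegral_univ,
      integral_condDensityY hR1 hK hGi hy (hloc y hy), div_self (hR1.density_pos y hy).ne',
      ENNReal.ofReal_one]
  · rw [show κ y = _ from if_neg hy]
    exact measure_univ

lemma integral_weight_withDensity (hR1 : M.OutcomeRegular P)
    (hK : HasCondDistrib M.ε (M.W P) K P)
    (hGi : Integrable G) {y : ℝ} (hy : y ∈ interior (M.suppY P))
    (hloc : ∀ᵐ w ∂(P.map (M.W P)), ∃ f, M.LocalRegular P K y G w f)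
    (φ : ℝ × ℝ × Covariates k → ℝ) :
    ∫ w, φ w ∂((P.map (M.W P)).withDensity
        fun w => ENNReal.ofReal (M.weight P K y w.1 w.2.1 w.2.2)) =
      ∫ w, M.weight P K y w.1 w.2.1 w.2.2 * φ w ∂(P.map (M.W P)) := by
  have hm : AEMeasurable (fun w : ℝ × ℝ × Covariates k => M.weight P K y w.1 w.2.1 w.2.2)
      (P.map (M.W P)) :=
    ((integrable_condDensityY hK hGi hloc).div_const _).aestronglyMeasurable.aemeasurable
  rw [integral_withDensity_eq_integral_toReal_smul₀ hm.ennreal_ofReal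
    (.of_forall fun _ => ENNReal.ofReal_lt_top)]
  refine integral_congr_ae ?_
  filter_upwards [hloc] with w ⟨f, hf⟩
  rw [ENNReal.toReal_ofReal (weight_nonneg hR1 hy hf), smul_eq_mul]

lemma integrable_weight_withDensity (hR1 : M.OutcomeRegular P)
    (hK : HasCondDistrib M.ε (M.W P) K P)
    (hGi : Integrable G) {y : ℝ} (hy : y ∈ interior (M.suppY P))
    (hloc : ∀ᵐ w ∂(P.map (M.W P)), ∃ f, M.LocalRegular P K y G w f)
    {φ : ℝ × ℝ × Covariates k → ℝ}
    (hφ : Integrable (fun w => M.weight P K y w.1 w.2.1 w.2.2 * φ w) (P.map (M.W P))) :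
    Integrable φ ((P.map (M.W P)).withDensity
        fun w => ENNReal.ofReal (M.weight P K y w.1 w.2.1 w.2.2)) := by
  have hm : AEMeasurable (fun w : ℝ × ℝ × Covariates k => M.weight P K y w.1 w.2.1 w.2.2)
      (P.map (M.W P)) :=
    ((integrable_condDensityY hK hGi hloc).div_const _).aestronglyMeasurable.aemeasurable
  rw [integrable_withDensity_iff_integrable_smul₀' hm.ennreal_ofReal
    (.of_forall fun _ => ENNReal.ofReal_lt_top)]
  refine hφ.congr ?_
  filter_upwards [hloc] with w ⟨f, hf⟩
  rw [ENNReal.toReal_ofReal (weight_nonneg hR1 hy hf), smul_eq_mul]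

/-- For each `B`, the measure `P(Y ∈ ·, W ∈ B)` has density `∫_B f_{Y|W} dF_W`, by the strip limits;
`B = univ` gives `f_Y`, and the quotient is `κ y B`. Weak continuity is dominated convergence for
the conditional densities. -/
lemma isContinuousCondDistrib_of_eq_weight (hR1 : M.OutcomeRegular P)
    (hK : HasCondDistrib M.ε (M.W P) K P)
    (hGi : Integrable G)
    (hloc : ∀ y ∈ interior (M.suppY P), ∀ᵐ w ∂(P.map (M.W P)), ∃ f, M.LocalRegular P K y G w f)
    [NullSingletonClass (P.map M.Y)] {a b : ℝ} (hab : a < b) (hs : M.suppY P = Icc a b)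
    {κ : Kernel ℝ (ℝ × ℝ × Covariates k)} [IsMarkovKernel κ]
    (hκ : ∀ y ∈ interior (M.suppY P), κ y = (P.map (M.W P)).withDensity
        fun w => ENNReal.ofReal (M.weight P K y w.1 w.2.1 w.2.2)) :
    IsContinuousCondDistrib P (M.W P) M.Y (interior (M.suppY P)) κ := by
  have := Measure.isProbabilityMeasure_map (μ := P) (M.measurable_W P).aemeasurable
  have := Measure.isProbabilityMeasure_map (μ := P) M.measurable_Y.aemeasurable
  have hO : interior (M.suppY P) = Ioo a b := by rw [hs, interior_Icc]
  have hfull : P.map M.Y (Icc a b)ᶜ = 0 := by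
    rw [← hs]
    exact Measure.measure_compl_support
  refine ⟨inferInstance, ⟨(M.measurable_Y.prodMk (M.measurable_W P)).aemeasurable, ?_⟩, ?_⟩
  · have hlaw : ∀ B : Set (ℝ × ℝ × Covariates k), MeasurableSet B →
        (P.restrict (M.W P ⁻¹' B)).map M.Y = (volume.restrict (Ioo a b)).withDensity
          fun y => ENNReal.ofReal
            (∫ w in B, M.condDensityY K y w.1 w.2.1 w.2.2 ∂(P.map (M.W P))) := by
      intro B hB
      have hle : (P.restrict (M.W P ⁻¹' B)).map M.Y ≤ P.map M.Y :=
        Measure.map_mono Measure.restrict_le_self M.measurable_Y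
      have : NullSingletonClass ((P.restrict (M.W P ⁻¹' B)).map M.Y) :=
        ⟨fun x => le_antisymm ((hle _).trans (measure_singleton x).le) bot_le⟩
      refine eq_withDensity_of_tendsto_average hab
        (le_antisymm ((hle _).trans hfull.le) bot_le) (B := ∫ y', G y')
        (hO ▸ setIntegral_condDensityY_continuousOn hK hGi hloc hB) (fun y hy => ?_)
        (fun y hy => ?_) (fun y hy => ?_)
      all_goals rw [← hO] at hy
      · refine setIntegral_nonneg_of_ae ?_
        filter_upwards [hloc y hy] with w ⟨f, hf⟩
        exact hf.condDensityY_nonneg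
      · have hn : 0 ≤ᵐ[P.map (M.W P)] fun w : ℝ × ℝ × Covariates k =>
            M.condDensityY K y w.1 w.2.1 w.2.2 := by
          filter_upwards [hloc y hy] with w ⟨f, hf⟩
          exact hf.condDensityY_nonneg
        have hi := integrable_condDensityY hK hGi (hloc y hy)
        refine (setIntegral_le_integral hi hn).trans ?_
        have h1 : ∫ w, M.condDensityY K y w.1 w.2.1 w.2.2 ∂(P.map (M.W P)) ≤
            ∫ _, (∫ y', G y') ∂(P.map (M.W P)) := by
          refine integral_mono_ae hi (integrable_const _) ?_
          filter_upwards [hloc y hy] with w ⟨f, hf⟩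
          exact hf.condDensityY_le
        simpa using h1
      · refine (tendsto_average_condDensityY hK hGi (hloc y hy) hB).congr fun h => ?_
        rw [map_measureReal_apply M.measurable_Y measurableSet_Ioc,
          measureReal_restrict_apply (M.measurable_Y measurableSet_Ioc)]
    have hY : P.map M.Y = (volume.restrict (Ioo a b)).withDensity
        fun y => ENNReal.ofReal (M.fY P y) := by
      have h := hlaw univ MeasurableSet.univ
      rw [preimage_univ, Measure.restrict_univ] at h
      rw [h]
      refine withDensity_congr_ae ?_
      filter_upwards [ae_restrict_mem measurableSet_Ioo] with y hy
      rw [← hO] at hy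
      rw [setIntegral_univ, integral_condDensityY hR1 hK hGi hy (hloc y hy)]
    refine Measure.ext_prod fun {s B} hs hB => ?_
    have hleft : P.map (fun ω => (M.Y ω, M.W P ω)) (s ×ˢ B) =
        (P.restrict (M.W P ⁻¹' B)).map M.Y s := by
      rw [Measure.map_apply (M.measurable_Y.prodMk (M.measurable_W P)) (hs.prod hB),
        Measure.map_apply M.measurable_Y hs, Measure.restrict_apply (M.measurable_Y hs)]
      rfl
    have hfm : Measurable fun y => ENNReal.ofReal (M.fY P y) :=
      (measurable_deriv _).ennreal_ofReal
    rw [hleft, hlaw B hB, Measure.compProd_apply_prod hs hB, hY,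
      setLIntegral_withDensity_eq_setLIntegral_mul _ hfm (Kernel.measurable_coe κ hB) hs,
      withDensity_apply _ hs]
    refine lintegral_congr_ae (ae_restrict_of_ae ?_)
    filter_upwards [ae_restrict_mem measurableSet_Ioo] with y hy
    rw [← hO] at hy
    have hpos := hR1.density_pos y hy
    rw [Pi.mul_apply, hκ y hy, weight_withDensity_apply hR1 hK hGi hy (hloc y hy) hB,
      ← ENNReal.ofReal_mul hpos.le, mul_div_cancel₀ _ hpos.ne']
  · rintro φ hφ ⟨B, hB⟩ y hy
    have h1 : ContinuousAt (fun u => M.fY P u) y := by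
      have h2 := (continuousAt_integral_mul_condDensityY hK hGi hloc hy
        (measurable_const (a := (1 : ℝ))) (B := 1) fun _ => by simp)
      refine h2.congr ?_
      filter_upwards [isOpen_interior.mem_nhds hy] with u hu
      simp only [one_mul]
      exact integral_condDensityY hR1 hK hGi hu (hloc u hu)
    have h2 := (continuousAt_integral_mul_condDensityY hK hGi hloc hy hφ.measurable hB).div h1
      (hR1.density_pos y hy).ne'
    refine ContinuousAt.continuousWithinAt (h2.congr ?_)
    filter_upwards [isOpen_interior.mem_nhds hy] with u hu
    rw [hκ u hu, integral_weight_withDensity hR1 hK hGi hu (hloc u hu), Pi.div_apply,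
      ← integral_div]
    refine integral_congr_ae (.of_forall fun w => ?_)
    simp only [weight]
    ring

lemma isMarginalPolicyEffect_quantile (hR1 : M.OutcomeRegular P) {f : ℝ → ℝ → ℝ}
    (H : DominatedDensity P M.Y (fun ω => M.mDot (M.D ω) (M.X ω) (M.ε ω)) f G)
    [NullSingletonClass (P.map M.Y)] {τ : ℝ} (hτ : τ ∈ Ioo (0 : ℝ) 1)
    (hq : M.qY P τ ∈ interior (M.suppY P))
    (hc : ∀ y', ContinuousAt (fun u => f u y') (M.qY P τ)) :
    IsMarginalPolicyEffect P (fun F => quantile F τ) M.Y M.Ycf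
      ((∫ y', y' * f (M.qY P τ) y') / M.fY P (M.qY P τ)) := by
  have := Measure.isProbabilityMeasure_map (μ := P) M.measurable_Y.aemeasurable
  have hpos := hR1.density_pos _ hq
  have hf : M.fY P (M.qY P τ) = ∫ y', f (M.qY P τ) y' :=
    H.deriv_cdf hc (differentiableAt_of_deriv_ne_zero hpos.ne')
  rw [hf] at hpos ⊢
  have hm : ∀ᶠ t in 𝓝[>] (0 : ℝ), Measurable (M.Ycf t) := by
    filter_upwards [Ioc_mem_nhdsGT zero_lt_one] with t ht
    exact M.measurable_Ycf ⟨ht.1.le, ht.2⟩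
  have h := H.tendsto_quantile hc (Ut := M.Ycf) hR1.expansion hm hτ
    (cdf_quantile (P.map M.Y) hτ) hpos
  exact h.congr fun t => by rw [div_eq_inv_mul]; rfl

end TriangularModel

/-! ### The main theorem -/

theorem corollary4 {Ω E : Type*} [MeasurableSpace Ω] [StandardBorelSpace Ω]
    [MeasurableSpace E] [StandardBorelSpace E] {k : ℕ}
    (P : Measure Ω) [IsProbabilityMeasure P] (M : TriangularModel Ω E k)
    (K : Kernel (ℝ × ℝ × Covariates k) E) [IsMarkovKernel K]
    (hK : HasCondDistrib M.ε (M.W P) K P)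
    (hD : ∀ᵐ p ∂(P.map fun ω => (M.V P ω, M.X ω)),
      NullSingletonClass (condDistrib M.D (fun ω => (M.V P ω, M.X ω)) P p))
    (hR1 : M.OutcomeRegular P)
    (hC : M.ControlConditions P)
    (hR3 : M.ConditionalRegular P K)
    (hsupp : ∃ a b : ℝ, M.suppY P = Icc a b)
    (hfrontier : ∀ y ∈ interior (M.suppY P),
      ∀ᵐ ω ∂P, y ∉ frontier (M.condSuppY K (M.D ω) (M.V P ω) (M.X ω))) :
    ∃ κ : Kernel ℝ (ℝ × ℝ × Covariates k),
      IsContinuousCondDistrib P (M.W P) M.Y (interior (M.suppY P)) κ ∧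
      ∀ τ ∈ Ioo (0 : ℝ) 1, ∃ θ : ℝ,
        IsMarginalPolicyEffect P (fun F => quantile F τ) M.Y M.Ycf θ ∧
        -- first expression
        Integrable (fun w : ℝ × ℝ × Covariates k =>
          M.policyDot w.1 * M.dCondCdfY P K (M.qY P τ) w.1 w.2.1 w.2.2) (P.map (M.W P)) ∧
        θ = -1 / M.fY P (M.qY P τ) *
          ∫ w : ℝ × ℝ × Covariates k,
            M.policyDot w.1 * M.dCondCdfY P K (M.qY P τ) w.1 w.2.1 w.2.2 ∂(P.map (M.W P)) ∧
        -- the matching function is well defined wherever it receives weight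
        (∀ᵐ w ∂(P.map (M.W P)), M.weight P K (M.qY P τ) w.1 w.2.1 w.2.2 ≠ 0 →
          M.matchingSet P K τ w.1 w.2.1 w.2.2 = {M.zeta P K τ w.1 w.2.1 w.2.2}) ∧
        -- second expression
        Integrable (fun w : ℝ × ℝ × Covariates k =>
          M.policyDot w.1 * (M.weight P K (M.qY P τ) w.1 w.2.1 w.2.2 *
            M.betaCQD P K (M.zeta P K τ w.1 w.2.1 w.2.2) w.1 w.2.1 w.2.2)) (P.map (M.W P)) ∧
        θ = ∫ w : ℝ × ℝ × Covariates k,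
          M.policyDot w.1 * (M.weight P K (M.qY P τ) w.1 w.2.1 w.2.2 *
            M.betaCQD P K (M.zeta P K τ w.1 w.2.1 w.2.2) w.1 w.2.1 w.2.2) ∂(P.map (M.W P)) ∧
        -- third expression
        Integrable (fun w : ℝ × ℝ × Covariates k =>
          M.policyDot w.1 * M.betaCQD P K (M.zeta P K τ w.1 w.2.1 w.2.2) w.1 w.2.1 w.2.2)
          (κ (M.qY P τ)) ∧
        θ = ∫ w : ℝ × ℝ × Covariates k,
          M.policyDot w.1 * M.betaCQD P K (M.zeta P K τ w.1 w.2.1 w.2.2) w.1 w.2.1 w.2.2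
            ∂(κ (M.qY P τ)) := by
  obtain ⟨a, b, hs⟩ := hsupp
  obtain ⟨f, G₀, H, hcont⟩ := M.exists_dominatedDensity_outcome P hR1
  obtain ⟨G, hGi, hGm, hloc⟩ := M.exists_ae_localRegular P K hK hD hC hR3 hfrontier
  have hYn : NullSingletonClass (P.map M.Y) := H.nullSingletonClass_map
  have hYp := Measure.isProbabilityMeasure_map (μ := P) M.measurable_Y.aemeasurable
  have hq : ∀ τ ∈ Ioo (0 : ℝ) 1, M.qY P τ ∈ interior (M.suppY P) := fun τ hτ =>
    quantile_mem_interior_support (P.map M.Y) hs hτ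
  -- Any quantile lies strictly between `a` and `b`; the median serves.
  have hab : a < b := by
    have h := hq (1 / 2) ⟨by norm_num, by norm_num⟩
    rw [hs, interior_Icc] at h
    exact h.1.trans h.2
  obtain ⟨κ, hκM, hκ⟩ := TriangularModel.exists_kernel_weight hR1 hK hGi hloc
  refine ⟨κ, TriangularModel.isContinuousCondDistrib_of_eq_weight hR1 hK hGi hloc hab hs hκ,
    fun τ hτ => ⟨(∫ y', y' * f (M.qY P τ) y') / M.fY P (M.qY P τ), ?_⟩⟩
  have hy := hq τ hτ
  have hpos := hR1.density_pos _ hy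
  have hl := hloc _ hy
  obtain ⟨hint1, heq1⟩ :=
    TriangularModel.integral_policyDot_mul_dCondCdfY hK hGm H (hcont _ hy) hl
  -- Pointwise, `f_{Y|W} β = B_w = -∂_d F`; this transfers both the value and the integrability of
  -- the first expression to the second.
  have hae : (fun w : ℝ × ℝ × Covariates k =>
      M.policyDot w.1 * (M.weight P K (M.qY P τ) w.1 w.2.1 w.2.2 *
        M.betaCQD P K (M.zeta P K τ w.1 w.2.1 w.2.2) w.1 w.2.1 w.2.2)) =ᵐ[P.map (M.W P)]
      fun w => -1 / M.fY P (M.qY P τ) *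
        (M.policyDot w.1 * M.dCondCdfY P K (M.qY P τ) w.1 w.2.1 w.2.2) := by
    filter_upwards [hl] with w ⟨fw, hw⟩
    rw [TriangularModel.weight, div_mul_eq_mul_div, hw.condDensityY_mul_betaCQD τ rfl,
      hw.dCondCdfY_eq]
    ring
  have hfirst : (∫ y', y' * f (M.qY P τ) y') / M.fY P (M.qY P τ) =
      -1 / M.fY P (M.qY P τ) * ∫ w : ℝ × ℝ × Covariates k,
        M.policyDot w.1 * M.dCondCdfY P K (M.qY P τ) w.1 w.2.1 w.2.2 ∂(P.map (M.W P)) := by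
    rw [heq1]
    ring
  have hint2 := (hint1.const_mul (-1 / M.fY P (M.qY P τ))).congr hae.symm
  have hsecond : (∫ y', y' * f (M.qY P τ) y') / M.fY P (M.qY P τ) =
      ∫ w : ℝ × ℝ × Covariates k,
          M.policyDot w.1 * (M.weight P K (M.qY P τ) w.1 w.2.1 w.2.2 *
            M.betaCQD P K (M.zeta P K τ w.1 w.2.1 w.2.2) w.1 w.2.1 w.2.2) ∂(P.map (M.W P)) := by
    rw [integral_congr_ae hae, integral_const_mul, hfirst]
  refine ⟨TriangularModel.isMarginalPolicyEffect_quantile hR1 H hτ hy (hcont _ hy), hint1, hfirst,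
    ?_, hint2, hsecond, ?_, ?_⟩
  · filter_upwards [hl] with w ⟨fw, hw⟩ hne
    exact hw.matchingSet_eq τ rfl fun h0 => hne (by rw [TriangularModel.weight, h0, zero_div])
  · rw [hκ _ hy]
    refine TriangularModel.integrable_weight_withDensity hR1 hK hGi hy hl
      (hint2.congr (.of_forall fun w => ?_))
    exact mul_left_comm _ _ _
  · rw [hκ _ hy, TriangularModel.integral_weight_withDensity hR1 hK hGi hy hl, hsecond]
    exact integral_congr_ae (.of_forall fun w => mul_left_comm _ _ _)
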